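/- Let $p$ be an odd prime, let $n\ge 3$, and let $$G=\left\langle x,y \mid x^{p^{n-1}},\ y^p,\ y^{-1}xy=x^{1+p^{n-2}}\right\rangle$$ be the metacyclic group of order $p^n$. Let $A=\mathrm{Aut}(G)$ and let $Z=Z(A)$ be the center of $A$. Let $a$ be an integer whose class generates the multiplicative group $(\mathbb{Z}/p^{n-2}\mathbb{Z})^\times$, and let $b$ be an integer with $ab\equiv 1\pmod p$. Then the following hold. (1) (Schulte's presentation.) There are integers $j,k$ such that $A$ is generated by elements $x_1,x_2,x_3$ with defining relators $$x_1^p,\quad x_2^p,\quad x_3^{(p-1)p^{n-2}},\quad x_1^{-a}x_3^{-1}x_1x_3\,x_3^{j(p-1)p^{n-3}},\quad x_2^{-b}x_3^{-1}x_2x_3\,x_3^{k(p-1)p^{n-3}},\quad x_1^{-1}x_2^{-1}x_1x_2\,x_3^{-(p-1)p^{n-3}},$$ and $Z=\langle x_3^{p-1}\rangle$. (2) The canonical map $\mathrm{Aut}(A)\to\mathrm{Aut}(A/Z)$, which sends $\psi$ to $gZ\mapsto\psi(g)Z$, is surjective. (3) Every $\varphi\in\mathrm{Aut}(A/Z)$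 has exactly $p^{n-3}$ homomorphic lifts, that is, there are exactly $p^{n-3}$ endomorphisms $\psi$ of $A$ such that $\psi(g)Z=\varphi(gZ)$ for all $g\in A$; and each of these lifts is an automorphism of $A$. -/

import Mathlib

/-- The defining relators of the metacyclic group, as words in the free group on `x = of 0`
and `y = of 1`: `x ^ p ^ (n - 1)`, `y ^ p` and `y⁻¹ x y = x ^ (1 + p ^ (n - 2))`. -/
def metacyclicRels (p n : ℕ) : Set (FreeGroup (Fin 2)) :=
  let x : FreeGroup (Fin 2) := FreeGroup.of 0
  let y : FreeGroup (Fin 2) := FreeGroup.of 1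
  {x ^ p ^ (n - 1), y ^ p, y⁻¹ * x * y * (x ^ (1 + p ^ (n - 2)))⁻¹}

/-- The metacyclic group `⟨x, y | x ^ p ^ (n - 1), y ^ p, x ^ y = x ^ (1 + p ^ (n - 2))⟩`. -/
abbrev MetacyclicGroup (p n : ℕ) : Type := PresentedGroup (metacyclicRels p n)

/-- The relators of Schulte's presentation, as words in the free group on
`x₁ = of 0`, `x₂ = of 1`, `x₃ = of 2`. -/
def schulteRels (p n : ℕ) (a b j k : ℤ) : Set (FreeGroup (Fin 3)) :=
  let x₁ : FreeGroup (Fin 3) := FreeGroup.of 0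
  let x₂ : FreeGroup (Fin 3) := FreeGroup.of 1
  let x₃ : FreeGroup (Fin 3) := FreeGroup.of 2
  {x₁ ^ p,
   x₂ ^ p,
   x₃ ^ ((p - 1) * p ^ (n - 2)),
   x₁ ^ (-a) * x₃⁻¹ * x₁ * x₃ * x₃ ^ (j * ((p : ℤ) - 1) * (p : ℤ) ^ (n - 3)),
   x₂ ^ (-b) * x₃⁻¹ * x₂ * x₃ * x₃ ^ (k * ((p : ℤ) - 1) * (p : ℤ) ^ (n - 3)),
   x₁⁻¹ * x₂⁻¹ * x₁ * x₂ * x₃ ^ (-(((p : ℤ) - 1) * (p : ℤ) ^ (n - 3)))}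

/-- The group defined by Schulte's presentation. -/
abbrev SchulteGroup (p n : ℕ) (a b j k : ℤ) : Type := PresentedGroup (schulteRels p n a b j k)

/-- `ψ ∈ End(A)` is a lift of `φ ∈ End(A / N)` if `ψ(g) N = φ(g N)` for all `g`. -/
def IsLift {A : Type*} [Group A] {N : Subgroup A} [N.Normal]
    (φ : A ⧸ N →* A ⧸ N) (ψ : A →* A) : Prop :=
  ∀ g : A, (QuotientGroup.mk (ψ g) : A ⧸ N) = φ (QuotientGroup.mk g)

/-- The canonical homomorphism `Aut(A) → Aut(A / N)`, for `N` characteristic in `A`, given by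
acting on coset representatives: `ψ` is sent to `g N ↦ ψ(g) N`. -/
def autQuotient {A : Type*} [Group A] (N : Subgroup A) [N.Characteristic] :
    MulAut A →* MulAut (A ⧸ N) where
  toFun ψ := QuotientGroup.congr N N ψ (Subgroup.characteristic_iff_map_eq.mp inferInstance ψ)
  map_one' := by
    ext q
    induction q using QuotientGroup.induction_on
    rfl
  map_mul' _ _ := by
    ext q
    induction q using QuotientGroup.induction_on
    rfl

/-! Write n = r + 3. The argument separates the computation of Aut(G) from the lifting problem,
which uses only the presentation and its normal form (`SchulteBasis`).

For the presentation, automorphisms of G are exactly x ↦ x^i y^j, y ↦ c^k y with p ∤ i, where c =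
x^(p^(r+1)) is central of order p (`MetacyclicBasis.mulAut_apply`, `MetacyclicBasis.exists_mulAut`).
A transvection x₁, a shear x₂ and the power map x₃ : x ↦ x^g generate them, g being a primitive root
modulo p^(r+2) with g ≡ a mod p. Only residues modulo p matter in the exponents a and b, since x₁
and x₂ have order p. A suitable choice of x₁ and x₂ makes both j and k vanish
(`MetacyclicBasis.exists_schulteTriple`). Unique normal forms identify A with the presented group
without counting orders (`SchulteTriple.exists_mulEquiv`).

For the lifts, put ζ = x₃^(p-1) and z = ζ^(p^r) = [x₁, x₂]. Then Z = ⟨ζ⟩ is cyclic of order p^(r+1),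
and elements whose p-th power is central lie in ⟨x₁, x₂⟩Z. Given φ, choose preimages of the images
of the generators, the first two of exponent p. Each conjugation relation fails by a power of z,
which a central factor repairs because a - 1 and b - 1 are prime to p. The commutator relation is
then repaired by a central factor on the third preimage, because p - 1 is prime to |Z|
(`SchulteBasis.exists_isLift`). The first two images are forced, and the third is free up to the
subgroup ⟨ζ^p⟩ of order p^r (`SchulteBasis.card_lifts`). A lift of an automorphism with nontrivial
kernel would kill z, and this would make x₁ and x₂ commute (`SchulteBasis.bijective_of_isLift`). -/

/-! ### Commutator calculus in class two. -/

/-- If `x * y = y * x * c` with `c` commuting with `x` and `y`, then powers of `x` and `y`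
commute up to a power of `c`. -/
theorem zpow_mul_zpow_of_commutator {A : Type*} [Group A] {x y c : A} (h : x * y = y * x * c)
    (hx : Commute c x) (hy : Commute c y) (i j : ℤ) :
    x ^ i * y ^ j = y ^ j * x ^ i * c ^ (i * j) := by
  have h1 : SemiconjBy y (x * c) x := by
    rw [SemiconjBy, ← mul_assoc, ← h]
  have h2 : SemiconjBy (x ^ i) y (y * c ^ i) := by
    have := (h1.zpow_right i).eq
    rw [hx.symm.mul_zpow, (hx.zpow_zpow i i).symm.eq, ← mul_assoc] at this
    exact this.symm
  have h3 := (h2.zpow_right j).eq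
  rw [(hy.zpow_left i).symm.mul_zpow, ← zpow_mul, mul_assoc, ((hx.zpow_zpow (i * j) i)).eq,
    ← mul_assoc] at h3
  exact h3

/-- The power formula in nilpotency class two. -/
theorem mul_pow_of_commutator {A : Type*} [Group A] {x y c : A} (h : x * y = y * x * c)
    (hx : Commute c x) (hy : Commute c y) (k : ℕ) :
    (x * y) ^ k = x ^ k * y ^ k * c ^ (-(k.choose 2 : ℤ)) := by
  induction k with
  | zero => simp
  | succ k ih =>
    have h1 := zpow_mul_zpow_of_commutator h hx hy 1 k
    rw [zpow_one, one_mul, zpow_natCast] at h1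
    have h2 : y ^ k * x = x * y ^ k * c ^ (-(k : ℤ)) := by
      rw [h1, zpow_neg, mul_inv_cancel_right]
    have h3 : ∀ t : ℤ, Commute (c ^ t) (x * y) := fun t =>
      (hx.zpow_left t).mul_right (hy.zpow_left t)
    calc (x * y) ^ (k + 1) = x ^ k * y ^ k * (c ^ (-(k.choose 2 : ℤ)) * (x * y)) := by
          rw [pow_succ, ih, mul_assoc]
      _ = x ^ k * (y ^ k * x) * y * c ^ (-(k.choose 2 : ℤ)) := by
          rw [(h3 _).eq]; simp only [mul_assoc]
      _ = x ^ k * x * y ^ k * (c ^ (-(k : ℤ)) * y) * c ^ (-(k.choose 2 : ℤ)) := by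
          rw [h2]; simp only [mul_assoc]
      _ = x ^ (k + 1) * y ^ (k + 1) * (c ^ (-(k : ℤ)) * c ^ (-(k.choose 2 : ℤ))) := by
          rw [(hy.zpow_left _).eq, pow_succ, pow_succ]; simp only [mul_assoc]
      _ = _ := by
          rw [← zpow_add, Nat.choose_succ_succ' k 1, Nat.choose_one_right]
          push_cast
          congr 2
          ring

/-! ### Schulte's relations and the resulting normal form. -/

/-- Three elements satisfying Schulte's relations, with `n = r + 3` and `j = k = 0`. -/
structure SchulteTriple (p r : ℕ) (a b : ℤ) {A : Type*} [Group A] (x₁ x₂ x₃ : A) : Prop where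
  pow₁ : x₁ ^ p = 1
  pow₂ : x₂ ^ p = 1
  pow₃ : x₃ ^ ((p - 1) * p ^ (r + 1)) = 1
  conj₁ : x₁ * x₃ = x₃ * x₁ ^ a
  conj₂ : x₂ * x₃ = x₃ * x₂ ^ b
  comm : x₁ * x₂ = x₂ * x₁ * x₃ ^ ((p - 1) * p ^ r)

/-- The arithmetic hypotheses on `p`, `a` and `b`. -/
structure SchulteParameters (p : ℕ) (a b : ℤ) : Prop where
  prime : p.Prime
  ne_two : p ≠ 2
  mul_modEq : a * b ≡ 1 [ZMOD (p : ℤ)]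
  primitive : ∀ k : ℕ, a ^ k ≡ 1 [ZMOD (p : ℤ)] → p - 1 ∣ k

namespace SchulteParameters

variable {p : ℕ} {a b : ℤ}

theorem three_le (h : SchulteParameters p a b) : 3 ≤ p := by
  have := h.prime.two_le
  have := h.ne_two
  omega

theorem not_dvd_sub_one (h : SchulteParameters p a b) : ¬ (p : ℤ) ∣ a - 1 := by
  intro hd
  have h1 := h.primitive 1 (by rw [pow_one]; exact (Int.modEq_iff_dvd.mpr hd).symm)
  have := Nat.le_of_dvd one_pos h1
  have := h.three_le
  omega

theorem not_dvd_left (h : SchulteParameters p a b) : ¬ (p : ℤ) ∣ a := by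
  intro hd
  have h1 : (p : ℤ) ∣ 1 := by
    have := (Int.modEq_iff_dvd.mp h.mul_modEq)
    have h2 := dvd_add this (hd.mul_right b)
    simpa using h2
  have := Int.le_of_dvd one_pos h1
  have := h.three_le
  omega

theorem not_dvd_sub_one' (h : SchulteParameters p a b) : ¬ (p : ℤ) ∣ b - 1 := by
  intro hd
  apply h.not_dvd_sub_one
  have := (Int.modEq_iff_dvd.mp h.mul_modEq)
  have h2 := dvd_add this (hd.mul_left a)
  have h3 : (1 - a * b + a * (b - 1)) = -(a - 1) := by ring
  rw [h3] at h2
  exact (dvd_neg.mp h2)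

theorem pow_modEq_one (h : SchulteParameters p a b) : a ^ (p - 1) ≡ 1 [ZMOD (p : ℤ)] := by
  apply Int.ModEq.pow_card_sub_one_eq_one h.prime
  rw [isCoprime_comm]
  exact (Prime.coprime_iff_not_dvd (Nat.prime_iff_prime_int.mp h.prime)).mpr h.not_dvd_left

theorem pow_modEq_one' (h : SchulteParameters p a b) : b ^ (p - 1) ≡ 1 [ZMOD (p : ℤ)] := by
  have h1 := (h.mul_modEq).pow (p - 1)
  rw [mul_pow, one_pow] at h1
  have h2 := (h.pow_modEq_one.mul_right (b ^ (p - 1)))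
  rw [one_mul] at h2
  exact h2.symm.trans h1

end SchulteParameters

theorem zpow_eq_zpow_of_modEq {A : Type*} [Group A] {x : A} {k : ℕ} (hx : x ^ k = 1) {i j : ℤ}
    (h : i ≡ j [ZMOD (k : ℤ)]) : x ^ i = x ^ j := by
  obtain ⟨t, ht⟩ := Int.modEq_iff_dvd.mp h
  rw [show j = i + k * t by linarith, zpow_add, zpow_mul, zpow_natCast, hx, one_zpow, mul_one]

theorem zpow_eq_one_of_dvd {A : Type*} [Group A] {x : A} {k : ℕ} (hx : x ^ k = 1) {i : ℤ}
    (h : (k : ℤ) ∣ i) : x ^ i = 1 := by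
  obtain ⟨t, rfl⟩ := h
  rw [zpow_mul, zpow_natCast, hx, one_zpow]

/-- Families of automorphisms or permutations indexed additively by ℤ are used below; this evaluates
their powers by a change of parameter. -/
theorem zpow_eq_of_map_add {A : Type*} [Group A] {f : ℤ → A}
    (hf : ∀ u v, f (u + v) = f u * f v) (u : ℤ) : f 1 ^ u = f u := by
  let F : Multiplicative ℤ →* A := MonoidHom.mk' (fun u => f u.toAdd) fun u v => hf _ _
  have h := map_zpow F (Multiplicative.ofAdd 1) u
  rw [← ofAdd_zsmul, smul_eq_mul, mul_one] at h
  exact h.symm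

theorem mul_pow_of_mul_eq {A : Type*} [Group A] {x y : A} {a : ℤ} (h : x * y = y * x ^ a)
    (k : ℕ) (u : ℤ) : x ^ u * y ^ k = y ^ k * x ^ (a ^ k * u) := by
  induction k generalizing u with
  | zero => simp
  | succ k ih =>
    have h1 : ∀ u : ℤ, x ^ u * y = y * x ^ (a * u) := by
      intro u
      have : SemiconjBy y (x ^ a) x := h.symm
      have := (this.zpow_right u).eq
      rw [← zpow_mul] at this
      exact this.symm
    rw [pow_succ, ← mul_assoc, ih, mul_assoc, h1, ← mul_assoc]
    congr 2
    ring

namespace SchulteTriple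

variable {p r : ℕ} {a b : ℤ} {A : Type*} [Group A] {x₁ x₂ x₃ : A}

theorem map {B : Type*} [Group B] (f : A →* B) (h : SchulteTriple p r a b x₁ x₂ x₃) :
    SchulteTriple p r a b (f x₁) (f x₂) (f x₃) where
  pow₁ := by rw [← map_pow, h.pow₁, map_one]
  pow₂ := by rw [← map_pow, h.pow₂, map_one]
  pow₃ := by rw [← map_pow, h.pow₃, map_one]
  conj₁ := by rw [← map_mul, h.conj₁, map_mul, map_zpow]
  conj₂ := by rw [← map_mul, h.conj₂, map_mul, map_zpow]
  comm := by rw [← map_mul, h.comm, map_mul, map_mul, map_pow]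

/-- Conjugation by x₃^(p-1) raises x₁ to the power a^(p-1), which is 1 modulo p by Fermat. -/
theorem commute_pow₁ (h : SchulteTriple p r a b x₁ x₂ x₃) (hp : SchulteParameters p a b) :
    Commute x₁ (x₃ ^ (p - 1)) := by
  have h1 := mul_pow_of_mul_eq h.conj₁ (p - 1) 1
  rw [mul_one, zpow_one, zpow_eq_zpow_of_modEq h.pow₁ hp.pow_modEq_one, zpow_one] at h1
  exact h1

theorem commute_pow₂ (h : SchulteTriple p r a b x₁ x₂ x₃) (hp : SchulteParameters p a b) :
    Commute x₂ (x₃ ^ (p - 1)) := by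
  have h1 := mul_pow_of_mul_eq h.conj₂ (p - 1) 1
  rw [mul_one, zpow_one, zpow_eq_zpow_of_modEq h.pow₂ hp.pow_modEq_one', zpow_one] at h1
  exact h1

theorem commute_comm₁ (h : SchulteTriple p r a b x₁ x₂ x₃) (hp : SchulteParameters p a b) :
    Commute (x₃ ^ ((p - 1) * p ^ r)) x₁ := by
  rw [pow_mul]
  exact ((h.commute_pow₁ hp).pow_right _).symm

theorem commute_comm₂ (h : SchulteTriple p r a b x₁ x₂ x₃) (hp : SchulteParameters p a b) :
    Commute (x₃ ^ ((p - 1) * p ^ r)) x₂ := by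
  rw [pow_mul]
  exact ((h.commute_pow₂ hp).pow_right _).symm

theorem comm_pow (h : SchulteTriple p r a b x₁ x₂ x₃) : (x₃ ^ ((p - 1) * p ^ r)) ^ p = 1 := by
  rw [← pow_mul, mul_assoc, ← pow_succ, h.pow₃]

theorem zpow_mul_zpow (h : SchulteTriple p r a b x₁ x₂ x₃) (hp : SchulteParameters p a b)
    (u v : ℤ) : x₁ ^ u * x₂ ^ v = x₂ ^ v * x₁ ^ u * (x₃ ^ ((p - 1) * p ^ r)) ^ (u * v) :=
  zpow_mul_zpow_of_commutator h.comm (h.commute_comm₁ hp) (h.commute_comm₂ hp) u v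

theorem zpow_mul₁ (h : SchulteTriple p r a b x₁ x₂ x₃) (u : ℤ) :
    x₁ ^ u * x₃ = x₃ * x₁ ^ (a * u) := by
  simpa using mul_pow_of_mul_eq h.conj₁ 1 u

theorem zpow_mul₂ (h : SchulteTriple p r a b x₁ x₂ x₃) (u : ℤ) :
    x₂ ^ u * x₃ = x₃ * x₂ ^ (b * u) := by
  simpa using mul_pow_of_mul_eq h.conj₂ 1 u

theorem mul_zpow₁ (h : SchulteTriple p r a b x₁ x₂ x₃) (hp : SchulteParameters p a b) (u : ℤ) :
    x₃ * x₁ ^ u = x₁ ^ (b * u) * x₃ := by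
  rw [h.zpow_mul₁]
  congr 1
  apply zpow_eq_zpow_of_modEq h.pow₁
  have := (hp.mul_modEq.mul_right u).symm
  rwa [one_mul, mul_assoc] at this

theorem mul_zpow₂ (h : SchulteTriple p r a b x₁ x₂ x₃) (hp : SchulteParameters p a b) (u : ℤ) :
    x₃ * x₂ ^ u = x₂ ^ (a * u) * x₃ := by
  rw [h.zpow_mul₂]
  congr 1
  apply zpow_eq_zpow_of_modEq h.pow₂
  have := (hp.mul_modEq.mul_right u).symm
  rwa [one_mul, mul_comm a, mul_assoc] at this

/-- Every element of the subgroup generated by the triple has a normal form. -/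
theorem exists_eq_of_mem_closure (h : SchulteTriple p r a b x₁ x₂ x₃)
    (hp : SchulteParameters p a b) {g : A} (hg : g ∈ Subgroup.closure {x₁, x₂, x₃}) :
    ∃ u v w : ℤ, g = x₁ ^ u * x₂ ^ v * x₃ ^ w := by
  have hx2 : ∀ s u v w : ℤ, ∃ u' v' w' : ℤ,
      x₂ ^ s * (x₁ ^ u * x₂ ^ v * x₃ ^ w) = x₁ ^ u' * x₂ ^ v' * x₃ ^ w' := by
    intro s u v w
    refine ⟨u, s + v, ((p - 1) * p ^ r : ℕ) * -(u * s) + w, ?_⟩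
    have h1 := h.zpow_mul_zpow hp u s
    have h2 : x₂ ^ s * x₁ ^ u
        = x₁ ^ u * x₂ ^ s * (x₃ ^ ((p - 1) * p ^ r)) ^ (-(u * s)) := by
      rw [h1, zpow_neg, mul_inv_cancel_right]
    rw [← mul_assoc, ← mul_assoc, h2, mul_assoc (x₁ ^ u * x₂ ^ s),
      ((h.commute_comm₂ hp).zpow_zpow _ v).eq, zpow_add, zpow_add, zpow_mul x₃, zpow_natCast]
    simp only [mul_assoc]
  induction hg using Subgroup.closure_induction_left with
  | one => exact ⟨0, 0, 0, by simp⟩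
  | mul_left x hx y hy ih =>
    obtain ⟨u, v, w, rfl⟩ := ih
    rcases hx with rfl | rfl | rfl
    · exact ⟨1 + u, v, w, by rw [zpow_add, zpow_one]; simp only [mul_assoc]⟩
    · simpa using hx2 1 u v w
    · refine ⟨b * u, a * v, 1 + w, ?_⟩
      rw [zpow_add, zpow_one, ← mul_assoc, ← mul_assoc, h.mul_zpow₁ hp, mul_assoc _ x,
        h.mul_zpow₂ hp]
      simp only [mul_assoc]
  | inv_mul_cancel x hx y hy ih =>
    obtain ⟨u, v, w, rfl⟩ := ih
    rcases hx with rfl | rfl | rfl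
    · exact ⟨-1 + u, v, w, by rw [zpow_add, zpow_neg_one]; simp only [mul_assoc]⟩
    · simpa using hx2 (-1) u v w
    · refine ⟨a * u, b * v, -1 + w, ?_⟩
      rw [inv_mul_eq_iff_eq_mul, zpow_add, zpow_neg_one]
      simp only [← mul_assoc]
      rw [← h.zpow_mul₁, mul_assoc _ x, ← h.zpow_mul₂]
      simp only [mul_assoc, mul_inv_cancel_left]

end SchulteTriple

/-! ### The centre and the elements of exponent p modulo the centre. -/

/-- A triple satisfying Schulte's relations in a group presented by them, such that the normal form
`x₁ ^ u * x₂ ^ v * x₃ ^ w` is unique up to the obvious congruences. -/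
structure SchulteBasis (p r : ℕ) (a b : ℤ) {A : Type} [Group A] (x₁ x₂ x₃ : A) : Prop
    extends SchulteTriple p r a b x₁ x₂ x₃ where
  exists_eq : ∀ g : A, ∃ u v w : ℤ, g = x₁ ^ u * x₂ ^ v * x₃ ^ w
  indep : ∀ u v w : ℤ, x₁ ^ u * x₂ ^ v * x₃ ^ w = 1 →
    (p : ℤ) ∣ u ∧ (p : ℤ) ∣ v ∧ (((p - 1) * p ^ (r + 1) : ℕ) : ℤ) ∣ w
  exists_hom : ∀ {B : Type} [Group B] {y₁ y₂ y₃ : B}, SchulteTriple p r a b y₁ y₂ y₃ →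
    ∃ f : A →* B, f x₁ = y₁ ∧ f x₂ = y₂ ∧ f x₃ = y₃

namespace SchulteBasis

variable {p r : ℕ} {a b : ℤ} {A : Type} [Group A] {x₁ x₂ x₃ : A}

theorem hom_ext (h : SchulteBasis p r a b x₁ x₂ x₃) {B : Type*} [Group B] {f g : A →* B}
    (h₁ : f x₁ = g x₁) (h₂ : f x₂ = g x₂) (h₃ : f x₃ = g x₃) : f = g := by
  ext x
  obtain ⟨u, v, w, rfl⟩ := h.exists_eq x
  simp only [map_mul, map_zpow, h₁, h₂, h₃]

theorem pow_mem_center (h : SchulteBasis p r a b x₁ x₂ x₃) (hp : SchulteParameters p a b) :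
    x₃ ^ (p - 1) ∈ Subgroup.center A := by
  rw [Subgroup.mem_center_iff]
  intro g
  obtain ⟨u, v, w, rfl⟩ := h.exists_eq g
  exact (((h.commute_pow₁ hp).zpow_left u).mul_left ((h.commute_pow₂ hp).zpow_left v)).mul_left
    ((Commute.self_pow x₃ _).zpow_left w)

theorem zpow_eq_one_iff (h : SchulteBasis p r a b x₁ x₂ x₃) (w : ℤ) :
    x₃ ^ w = 1 ↔ (((p - 1) * p ^ (r + 1) : ℕ) : ℤ) ∣ w :=
  ⟨fun hw => (h.indep 0 0 w (by simpa using hw)).2.2, zpow_eq_one_of_dvd h.pow₃⟩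

theorem orderOf_eq (h : SchulteBasis p r a b x₁ x₂ x₃) :
    orderOf x₃ = (p - 1) * p ^ (r + 1) := by
  apply Nat.dvd_antisymm (orderOf_dvd_of_pow_eq_one h.pow₃)
  have := (h.zpow_eq_one_iff (orderOf x₃)).mp (by rw [zpow_natCast, pow_orderOf_eq_one])
  exact_mod_cast this

theorem comm_zpow_eq_one_iff (h : SchulteBasis p r a b x₁ x₂ x₃) (hp : SchulteParameters p a b)
    (w : ℤ) : (x₃ ^ ((p - 1) * p ^ r)) ^ w = 1 ↔ (p : ℤ) ∣ w := by
  rw [← zpow_natCast, ← zpow_mul, h.zpow_eq_one_iff, pow_succ, ← mul_assoc]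
  push_cast
  apply mul_dvd_mul_iff_left
  have := hp.three_le
  have h1 : (p - 1) * p ^ r ≠ 0 := mul_ne_zero (by omega) (pow_ne_zero _ (by omega))
  exact_mod_cast h1

/-- Commuting with x₃ forces p ∣ (a - 1)u and p ∣ (b - 1)v, so only a power of x₃ remains. Commuting
with x₁ then forces a^k ≡ 1 mod p, hence p - 1 ∣ k. -/
theorem center_eq (h : SchulteBasis p r a b x₁ x₂ x₃) (hp : SchulteParameters p a b) :
    Subgroup.center A = Subgroup.zpowers (x₃ ^ (p - 1)) := by
  apply le_antisymm
  · intro g hg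
    rw [Subgroup.mem_center_iff] at hg
    obtain ⟨u, v, w, rfl⟩ := h.exists_eq g
    have h1 : x₃ * (x₁ ^ (a * u) * x₂ ^ (b * v) * x₃ ^ w) = x₃ * (x₁ ^ u * x₂ ^ v * x₃ ^ w) := by
      have e : x₁ ^ u * x₂ ^ v * x₃ = x₃ * (x₁ ^ (a * u) * x₂ ^ (b * v)) := by
        rw [mul_assoc, h.zpow_mul₂, ← mul_assoc, h.zpow_mul₁, mul_assoc]
      rw [hg x₃, mul_assoc (x₁ ^ u * x₂ ^ v), (Commute.zpow_self x₃ w).eq,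
        ← mul_assoc (x₁ ^ u * x₂ ^ v), e, mul_assoc x₃]
    have h2 : x₁ ^ ((a - 1) * u) * x₂ ^ ((b - 1) * v) * x₃ ^ (0 : ℤ) = 1 := by
      have h3 := mul_right_cancel (mul_left_cancel h1)
      rw [zpow_zero, mul_one, sub_one_mul, sub_one_mul, zpow_sub, zpow_sub, ← zpow_neg x₁,
        ← zpow_neg x₂, (Commute.zpow_zpow_self x₁ (a * u) (-u)).eq, mul_assoc,
        ← mul_assoc (x₁ ^ (a * u)), h3]
      group
    have h3 := h.indep _ _ _ h2
    have hpr := Nat.prime_iff_prime_int.mp hp.prime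
    have hu := (hpr.dvd_or_dvd h3.1).resolve_left hp.not_dvd_sub_one
    have hv := (hpr.dvd_or_dvd h3.2.1).resolve_left hp.not_dvd_sub_one'
    rw [zpow_eq_one_of_dvd h.pow₁ hu, zpow_eq_one_of_dvd h.pow₂ hv, one_mul, one_mul] at hg ⊢
    have hN : 0 < (p - 1) * p ^ (r + 1) := by
      have := hp.three_le
      exact Nat.mul_pos (by omega) (pow_pos (by omega) _)
    -- A natural exponent is needed in order to write a^k in ℤ.
    obtain ⟨k, hk⟩ : ∃ k : ℕ, x₃ ^ w = x₃ ^ k := by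
      refine ⟨(w % ((p - 1) * p ^ (r + 1) : ℕ)).toNat, ?_⟩
      rw [← zpow_natCast]
      apply zpow_eq_zpow_of_modEq h.pow₃
      rw [Int.toNat_of_nonneg (Int.emod_nonneg _ (by exact_mod_cast hN.ne'))]
      exact (Int.mod_modEq _ _).symm
    rw [hk] at hg ⊢
    have h4 := mul_pow_of_mul_eq h.conj₁ k 1
    rw [zpow_one, hg x₁, mul_one] at h4
    have h5 := mul_left_cancel h4
    have h6 := h.indep (a ^ k - 1) 0 0 (by rw [zpow_sub, ← h5]; simp)
    obtain ⟨t, rfl⟩ := hp.primitive k (Int.modEq_iff_dvd.mpr h6.1).symm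
    rw [pow_mul]
    exact Subgroup.npow_mem_zpowers _ _
  · rw [Subgroup.zpowers_le]
    exact h.pow_mem_center hp

/-- Since p is odd, p divides the binomial coefficient in the class-two power formula, so the
commutator term vanishes. -/
theorem mul_zpow_pow (h : SchulteBasis p r a b x₁ x₂ x₃) (hp : SchulteParameters p a b)
    (u v : ℤ) : (x₁ ^ u * x₂ ^ v) ^ p = 1 := by
  have h1 := h.zpow_mul_zpow hp u v
  rw [mul_pow_of_commutator h1 (((h.commute_comm₁ hp).zpow_zpow _ _))
    (((h.commute_comm₂ hp).zpow_zpow _ _)), ← zpow_natCast, ← zpow_mul, mul_comm u, zpow_mul,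
    zpow_natCast, h.pow₁, one_zpow, ← zpow_natCast, ← zpow_mul, mul_comm v, zpow_mul,
    zpow_natCast, h.pow₂, one_zpow, one_mul, one_mul, ← zpow_mul]
  apply zpow_eq_one_of_dvd h.comm_pow
  apply dvd_mul_of_dvd_right
  rw [dvd_neg]
  have := hp.three_le
  exact_mod_cast hp.prime.dvd_choose_self (k := 2) (by norm_num) (by omega)

/-- Elements whose `p`-th power is central. -/
theorem exists_mul_of_pow_mem_center (h : SchulteBasis p r a b x₁ x₂ x₃)
    (hp : SchulteParameters p a b) {g : A} (hg : g ^ p ∈ Subgroup.center A) :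
    ∃ u v : ℤ, ∃ c ∈ Subgroup.center A, g = x₁ ^ u * x₂ ^ v * c := by
  have h3 := hp.three_le
  -- The character onto ℤ/(p-1) sending x₃ to 1 kills the centre. It gives p - 1 ∣ wp, and p ≡ 1 mod
  -- p - 1 then gives p - 1 ∣ w.
  have ht : SchulteTriple p r a b (1 : Multiplicative (ZMod (p - 1))) 1
      (Multiplicative.ofAdd 1) := by
    have hz : (Multiplicative.ofAdd (1 : ZMod (p - 1))) ^ (p - 1) = 1 := by
      rw [← ofAdd_nsmul]
      simp
    refine ⟨by simp, by simp, ?_, by simp, by simp, ?_⟩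
    · rw [pow_mul, hz, one_pow]
    · rw [pow_mul, hz, one_pow, mul_one, mul_one]
  obtain ⟨χ, hχ₁, hχ₂, hχ₃⟩ := h.exists_hom ht
  have hc : χ (g ^ p) = 1 := by
    rw [h.center_eq hp] at hg
    obtain ⟨k, hk⟩ := hg
    rw [← hk]
    simp only [map_zpow, map_pow, hχ₃]
    rw [← ofAdd_nsmul]
    simp
  obtain ⟨u, v, w, rfl⟩ := h.exists_eq g
  simp only [map_pow, map_mul, map_zpow, hχ₁, hχ₂, hχ₃, one_zpow, one_mul] at hc
  rw [← zpow_natCast, ← zpow_mul, ← ofAdd_zsmul, ofAdd_eq_one, zsmul_one,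
    ZMod.intCast_zmod_eq_zero_iff_dvd] at hc
  have hw : ((p - 1 : ℕ) : ℤ) ∣ w := by
    have h5 : ((p - 1 : ℕ) : ℤ) ∣ w * ((p - 1 : ℕ) : ℤ) := dvd_mul_left _ _
    have h6 := dvd_sub hc h5
    have h7 : (p : ℤ) - ((p - 1 : ℕ) : ℤ) = 1 := by omega
    rwa [← mul_sub, h7, mul_one] at h6
  obtain ⟨t, rfl⟩ := hw
  refine ⟨u, v, _, ?_, rfl⟩
  rw [zpow_mul, zpow_natCast]
  exact zpow_mem (h.pow_mem_center hp) _

/-- Central elements of exponent `p` are powers of the commutator of `x₁` and `x₂`. -/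
theorem exists_zpow_of_pow_eq_one (h : SchulteBasis p r a b x₁ x₂ x₃)
    (hp : SchulteParameters p a b) {c : A} (hc : c ∈ Subgroup.center A) (hcp : c ^ p = 1) :
    ∃ s : ℤ, c = (x₃ ^ ((p - 1) * p ^ r)) ^ s := by
  have h3 := hp.three_le
  rw [h.center_eq hp] at hc
  obtain ⟨k, rfl⟩ := hc
  simp only at hcp ⊢
  rw [← zpow_natCast, ← zpow_natCast, ← zpow_mul, ← zpow_mul, h.zpow_eq_one_iff, pow_succ,
    ← mul_assoc] at hcp
  push_cast at hcp
  rw [← mul_assoc, mul_dvd_mul_iff_right (by exact_mod_cast (by omega : p ≠ 0)),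
    mul_dvd_mul_iff_left (by exact_mod_cast (by omega : p - 1 ≠ 0))] at hcp
  obtain ⟨s, rfl⟩ := hcp
  refine ⟨s, ?_⟩
  rw [← zpow_natCast, ← zpow_natCast, ← zpow_mul, ← zpow_mul]
  congr 1
  push_cast
  ring

/-- A central element other than `1` has the commutator of `x₁` and `x₂` among its powers. -/
theorem exists_zpow_eq_comm (h : SchulteBasis p r a b x₁ x₂ x₃) (hp : SchulteParameters p a b)
    {c : A} (hc : c ∈ Subgroup.center A) (hc1 : c ≠ 1) :
    ∃ s : ℤ, c ^ s = x₃ ^ ((p - 1) * p ^ r) := by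
  have hpr := Nat.prime_iff_prime_int.mp hp.prime
  -- some iterated `p`-th power of `c` is nontrivial and killed by `p`
  have hex : ∃ k : ℕ, c ^ p ^ k = 1 := by
    refine ⟨r + 1, ?_⟩
    rw [h.center_eq hp] at hc
    obtain ⟨k, rfl⟩ := hc
    simp only
    rw [← zpow_natCast, ← zpow_mul, mul_comm, zpow_mul, zpow_natCast, ← pow_mul, h.pow₃, one_zpow]
  classical
  obtain ⟨k, hk⟩ : ∃ k, Nat.find hex = k + 1 := by
    apply Nat.exists_eq_succ_of_ne_zero
    intro h0
    have := Nat.find_spec hex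
    rw [h0] at this
    exact hc1 (by simpa using this)
  have h1 : c ^ p ^ (k + 1) = 1 := hk ▸ Nat.find_spec hex
  have h2 : c ^ p ^ k ≠ 1 := Nat.find_min hex (by omega)
  obtain ⟨s, hs⟩ := h.exists_zpow_of_pow_eq_one hp (pow_mem hc (p ^ k))
    (by rw [← pow_mul, ← pow_succ, h1])
  rw [hs, Ne, h.comm_zpow_eq_one_iff hp] at h2
  -- The last nontrivial iterated p-th power of c is z^s with p ∤ s, so Bézout recovers z from it.
  obtain ⟨x, y, hxy⟩ := (hpr.coprime_iff_not_dvd.mpr h2)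
  refine ⟨(p ^ k : ℕ) * y, ?_⟩
  rw [zpow_mul, zpow_natCast, hs, ← zpow_mul]
  conv_rhs => rw [← zpow_one (x₃ ^ ((p - 1) * p ^ r))]
  apply zpow_eq_zpow_of_modEq h.comm_pow
  rw [Int.modEq_iff_dvd]
  exact ⟨x, by linarith⟩

end SchulteBasis

/-! ### Lifting endomorphisms of the quotient by the centre. -/

theorem exists_mul_modEq {e m : ℤ} (h : IsCoprime e m) (s : ℤ) : ∃ t : ℤ, s ≡ e * t [ZMOD m] := by
  obtain ⟨x, y, hxy⟩ := h
  refine ⟨x * s, ?_⟩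
  rw [Int.modEq_iff_dvd]
  exact ⟨-(y * s), by linear_combination s * hxy⟩

theorem IsLift.comp_mk' {A : Type*} [Group A] {N : Subgroup A} [N.Normal] {φ : A ⧸ N →* A ⧸ N}
    {ψ : A →* A} (h : IsLift φ ψ) : (QuotientGroup.mk' N).comp ψ = φ.comp (QuotientGroup.mk' N) :=
  MonoidHom.ext h

theorem IsLift.of_comp_mk' {A : Type*} [Group A] {N : Subgroup A} [N.Normal]
    {φ : A ⧸ N →* A ⧸ N} {ψ : A →* A}
    (h : (QuotientGroup.mk' N).comp ψ = φ.comp (QuotientGroup.mk' N)) : IsLift φ ψ :=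
  fun g => DFunLike.congr_fun h g

theorem commute_of_mem_center {A : Type*} [Group A] {c : A} (hc : c ∈ Subgroup.center A) (g : A) :
    Commute c g :=
  (Subgroup.mem_center_iff.mp hc g).symm

theorem exists_eq_mul_of_mk_eq {A : Type*} [Group A] {N : Subgroup A} {g h : A}
    (hgh : (QuotientGroup.mk g : A ⧸ N) = QuotientGroup.mk h) : ∃ d ∈ N, h = g * d :=
  ⟨g⁻¹ * h, QuotientGroup.eq.mp hgh, by group⟩

theorem mk_mul_eq {A : Type*} [Group A] {N : Subgroup A} {c : A} (hc : c ∈ N) (g : A) :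
    (QuotientGroup.mk (g * c) : A ⧸ N) = QuotientGroup.mk g :=
  QuotientGroup.mk_mul_of_mem g hc

/-- If `Y` acts on `X` as a power `e ≢ 1`, then no nontrivial central change of `X` and `Y` keeps the
relations `X ^ p = 1` and `X * Y = Y * X ^ e`. -/
theorem eq_one_of_mul_eq_mul_zpow {A : Type*} [Group A] {p : ℕ} (hp : p.Prime)
    {e : ℤ} (he : ¬ (p : ℤ) ∣ e - 1) {X Y c d : A} (hc : c ∈ Subgroup.center A)
    (hd : d ∈ Subgroup.center A) (hX : X ^ p = 1) (hXc : (X * c) ^ p = 1)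
    (h₁ : X * Y = Y * X ^ e) (h₂ : X * c * (Y * d) = Y * d * (X * c) ^ e) : c = 1 := by
  have hcp : c ^ p = 1 := by
    rwa [(commute_of_mem_center hc _).symm.mul_pow, hX, one_mul] at hXc
  -- Moving the central factors aside, the two relations differ by c on the left and c^e on the
  -- right; d cancels.
  have h3 : c ^ (e - 1) = 1 := by
    have e₁ : X * c * (Y * d) = X * Y * d * c := by
      rw [mul_assoc X, (commute_of_mem_center hc (Y * d)).eq]
      simp only [mul_assoc]
    have e₂ : Y * d * (X * c) ^ e = Y * X ^ e * d * c ^ e := by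
      rw [(commute_of_mem_center hc _).symm.mul_zpow, mul_assoc Y, ← mul_assoc d,
        (commute_of_mem_center hd _).eq]
      simp only [mul_assoc]
    rw [e₁, e₂, h₁] at h₂
    rw [zpow_sub_one, ← mul_left_cancel h₂, mul_inv_cancel]
  obtain ⟨x, y, hxy⟩ := (Nat.prime_iff_prime_int.mp hp).coprime_iff_not_dvd.mpr he
  rw [← zpow_one c, ← hxy, zpow_add, mul_comm x, zpow_mul, mul_comm y, zpow_mul, h3, zpow_natCast,
    hcp, one_zpow, one_zpow, mul_one]

namespace SchulteBasis

variable {p r : ℕ} {a b : ℤ} {A : Type} [Group A] {x₁ x₂ x₃ : A}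

/-- A relation `X * Y = Y * X ^ e` that holds modulo the centre holds exactly after multiplying
`X` by a central element. -/
theorem exists_mul_eq_mul_zpow (h : SchulteBasis p r a b x₁ x₂ x₃) (hp : SchulteParameters p a b)
    {e : ℤ} (he : ¬ (p : ℤ) ∣ e - 1) {X Y : A} (hX : X ^ p = 1)
    (hXY : (QuotientGroup.mk (Y * X ^ e) : A ⧸ Subgroup.center A) = QuotientGroup.mk (X * Y)) :
    ∃ c ∈ Subgroup.center A, (X * c) ^ p = 1 ∧ (X * c) * Y = Y * (X * c) ^ e := by
  obtain ⟨d, hd, hdXY⟩ := exists_eq_mul_of_mk_eq hXY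
  -- The conjugate Y⁻¹XY = X^e d has exponent p, as does X, so the central error d does too.
  have hdp : d ^ p = 1 := by
    have h1 : Y⁻¹ * X * Y = X ^ e * d := by
      rw [mul_assoc, hdXY]
      group
    have h2 : (Y⁻¹ * X * Y) ^ p = Y⁻¹ * X ^ p * Y := by
      simpa using conj_pow (i := p) (a := Y⁻¹) (b := X)
    rw [h1, ((commute_of_mem_center hd _).symm).mul_pow, hX, ← zpow_natCast, ← zpow_mul,
      mul_comm e, zpow_mul, zpow_natCast, hX] at h2
    simpa using h2
  obtain ⟨s, rfl⟩ := h.exists_zpow_of_pow_eq_one hp hd hdp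
  have hpr := Nat.prime_iff_prime_int.mp hp.prime
  -- With d = z^s and X replaced by X z^t, the relation becomes s + t ≡ te mod p, that is, (e - 1)t
  -- ≡ s.
  obtain ⟨t, ht⟩ := exists_mul_modEq (hpr.coprime_iff_not_dvd.mpr he).symm s
  have hz : x₃ ^ ((p - 1) * p ^ r) ∈ Subgroup.center A := by
    rw [pow_mul]
    exact pow_mem (h.pow_mem_center hp) _
  have hc := zpow_mem hz t
  refine ⟨_, hc, ?_, ?_⟩
  · rw [(commute_of_mem_center hc _).symm.mul_pow, hX, one_mul]
    exact (zpow_natCast _ _).symm.trans ((zpow_mul _ _ _).symm.trans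
      (zpow_eq_one_of_dvd h.comm_pow (dvd_mul_left _ _)))
  · rw [mul_assoc, (commute_of_mem_center hc Y).eq, ← mul_assoc, hdXY, mul_assoc (Y * X ^ e),
      ← zpow_add, (commute_of_mem_center hc X).symm.mul_zpow, ← mul_assoc, ← zpow_mul]
    congr 1
    apply zpow_eq_zpow_of_modEq h.comm_pow
    have := ht.add_right t
    rwa [show (e - 1) * t + t = t * e by ring] at this

/-- Preimages of the three images are corrected by central factors until Schulte's relations hold
exactly. Injectivity of φ plays no role. -/
theorem exists_isLift (h : SchulteBasis p r a b x₁ x₂ x₃) (hp : SchulteParameters p a b)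
    (φ : A ⧸ Subgroup.center A →* A ⧸ Subgroup.center A) :
    ∃ ψ : A →* A, IsLift φ ψ := by
  have h3p := hp.three_le
  have hbar := h.toSchulteTriple.map (QuotientGroup.mk' (Subgroup.center A))
  have hφ := hbar.map φ
  have hV : ∀ q : A ⧸ Subgroup.center A, q ^ p = 1 →
      ∃ X : A, QuotientGroup.mk X = q ∧ X ^ p = 1 := by
    intro q hq
    obtain ⟨Y, rfl⟩ := QuotientGroup.mk_surjective q
    obtain ⟨u, v, c, hc, rfl⟩ := h.exists_mul_of_pow_mem_center hp
      ((QuotientGroup.eq_one_iff _).mp hq)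
    exact ⟨x₁ ^ u * x₂ ^ v, (mk_mul_eq hc _).symm, h.mul_zpow_pow hp u v⟩
  obtain ⟨Y₁, hY₁, hY₁p⟩ := hV _ hφ.pow₁
  obtain ⟨Y₂, hY₂, hY₂p⟩ := hV _ hφ.pow₂
  obtain ⟨Y₃, hY₃⟩ := QuotientGroup.mk_surjective (φ (QuotientGroup.mk' _ x₃))
  rw [← hY₁, ← hY₂, ← hY₃] at hφ
  obtain ⟨c₁, hc₁, hX₁p, hX₁⟩ := h.exists_mul_eq_mul_zpow hp hp.not_dvd_sub_one hY₁p
    hφ.conj₁.symm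
  obtain ⟨c₂, hc₂, hX₂p, hX₂⟩ := h.exists_mul_eq_mul_zpow hp hp.not_dvd_sub_one' hY₂p
    hφ.conj₂.symm
  rw [← mk_mul_eq hc₁ Y₁] at hφ hY₁
  rw [← mk_mul_eq hc₂ Y₂] at hφ hY₂
  generalize Y₁ * c₁ = X₁ at *
  generalize Y₂ * c₂ = X₂ at *
  have hφ₃ : (QuotientGroup.mk (Y₃ ^ (p - 1)) : A ⧸ Subgroup.center A) = 1 := by
    rw [QuotientGroup.mk_pow, hY₃, ← map_pow, ← map_pow]
    have : QuotientGroup.mk' (Subgroup.center A) (x₃ ^ (p - 1)) = 1 :=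
      (QuotientGroup.eq_one_iff _).mpr (h.pow_mem_center hp)
    rw [this, map_one]
  have hcomm := hφ.comm
  rw [pow_mul, ← QuotientGroup.mk_pow, hφ₃, one_pow, mul_one] at hcomm
  obtain ⟨d, hd, hdX⟩ := exists_eq_mul_of_mk_eq hcomm.symm
  change X₁ * X₂ = X₂ * X₁ * d at hdX
  have hdp : d ^ p = 1 := by
    have := zpow_mul_zpow_of_commutator hdX (commute_of_mem_center hd _)
      (commute_of_mem_center hd _) p 1
    rw [zpow_natCast, hX₁p] at this
    simpa using this
  obtain ⟨δ, rfl⟩ := h.exists_zpow_of_pow_eq_one hp hd hdp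
  have hY₃c := (QuotientGroup.eq_one_iff _).mp hφ₃
  rw [h.center_eq hp] at hY₃c
  obtain ⟨t, ht⟩ := hY₃c
  simp only at ht
  have hcop : IsCoprime ((p - 1 : ℕ) : ℤ) ((p ^ (r + 1) : ℕ) : ℤ) := by
    rw [Nat.isCoprime_iff_coprime]
    apply Nat.Coprime.pow_right
    rw [Nat.coprime_comm, hp.prime.coprime_iff_not_dvd]
    intro hd
    have := Nat.le_of_dvd (by omega) hd
    omega
  -- Here Y₃^(p-1) = ζ^t and [X₁, X₂] = z^δ. Multiplying Y₃ by ζ^s with (p - 1)s ≡ δ - t makes its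
  -- (p-1)-th power ζ^δ, whose p^r-th power is the required z^δ.
  obtain ⟨s, hs⟩ := exists_mul_modEq hcop (δ - t)
  have hζ := zpow_mem (h.pow_mem_center hp) s
  have hX₃ : (Y₃ * (x₃ ^ (p - 1)) ^ s) ^ (p - 1) = (x₃ ^ (p - 1)) ^ δ := by
    rw [(commute_of_mem_center hζ _).symm.mul_pow, ← ht, ← zpow_natCast (_ ^ s), ← zpow_mul,
      ← zpow_add]
    apply zpow_eq_zpow_of_modEq (k := p ^ (r + 1)) (by rw [← pow_mul, h.pow₃])
    have := (hs.add_left t).symm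
    rwa [add_sub_cancel, mul_comm _ s] at this
  have key : SchulteTriple p r a b X₁ X₂ (Y₃ * (x₃ ^ (p - 1)) ^ s) := by
    refine ⟨hX₁p, hX₂p, ?_, ?_, ?_, ?_⟩
    · rw [pow_mul, hX₃, ← zpow_natCast, ← zpow_mul, mul_comm, zpow_mul, zpow_natCast, ← pow_mul,
        h.pow₃, one_zpow]
    · rw [← mul_assoc, hX₁, mul_assoc, mul_assoc, (commute_of_mem_center hζ _).eq]
    · rw [← mul_assoc, hX₂, mul_assoc, mul_assoc, (commute_of_mem_center hζ _).eq]
    · rw [hdX, pow_mul (Y₃ * _), hX₃, pow_mul, ← zpow_natCast (x₃ ^ (p - 1)), ← zpow_mul,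
        ← zpow_natCast (_ ^ δ), ← zpow_mul, mul_comm δ]
  obtain ⟨ψ, h₁, h₂, h₃⟩ := h.exists_hom key
  refine ⟨ψ, IsLift.of_comp_mk' (h.hom_ext ?_ ?_ ?_)⟩
  · simp only [MonoidHom.comp_apply, h₁]
    exact hY₁
  · simp only [MonoidHom.comp_apply, h₂]
    exact hY₂
  · simp only [MonoidHom.comp_apply, h₃]
    exact (mk_mul_eq hζ _).trans hY₃

theorem finite (h : SchulteBasis p r a b x₁ x₂ x₃) (hp : SchulteParameters p a b) : Finite A := by
  have h3p := hp.three_le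
  have hf : ∀ {x : A} {k : ℕ}, 0 < k → x ^ k = 1 → (Subgroup.zpowers x : Set A).Finite := by
    intro x k hk hx
    exact (isOfFinOrder_iff_pow_eq_one.mpr ⟨k, hk, hx⟩).finite_zpowers
  have hs := ((hf (by omega) h.pow₁).mul (hf (by omega) h.pow₂)).mul
    (hf (Nat.mul_pos (by omega) (pow_pos (by omega) _)) h.pow₃)
  rw [← Set.finite_univ_iff]
  refine hs.subset fun g _ => ?_
  obtain ⟨u, v, w, rfl⟩ := h.exists_eq g
  exact Set.mul_mem_mul (Set.mul_mem_mul ⟨u, rfl⟩ ⟨v, rfl⟩) ⟨w, rfl⟩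

/-- Since φ is injective, a kernel element is central, and if nontrivial it has z among its powers.
Then ψ(x₁) and ψ(x₂) commute; as φ is onto, x₁ and x₂ are words in them up to central factors,
contradicting z ≠ 1. -/
theorem bijective_of_isLift (h : SchulteBasis p r a b x₁ x₂ x₃) (hp : SchulteParameters p a b)
    {φ : A ⧸ Subgroup.center A ≃* A ⧸ Subgroup.center A} {ψ : A →* A}
    (hψ : IsLift φ.toMonoidHom ψ) : Function.Bijective ψ := by
  have := h.finite hp
  rw [← Finite.injective_iff_bijective, injective_iff_map_eq_one]
  intro g hg
  by_contra hg1
  have hmk : ∀ x, ψ x ∈ Subgroup.center A ↔ x ∈ Subgroup.center A := by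
    intro x
    rw [← QuotientGroup.eq_one_iff, hψ x, ← QuotientGroup.eq_one_iff x]
    exact map_eq_one_iff φ φ.injective
  obtain ⟨s, hs⟩ := h.exists_zpow_eq_comm hp
    ((hmk g).mp (by rw [hg]; exact one_mem _)) hg1
  have hz : ψ (x₃ ^ ((p - 1) * p ^ r)) = 1 := by
    rw [← hs, map_zpow, hg, one_zpow]
  have hcomm : Commute (ψ x₁) (ψ x₂) := by
    have := congrArg ψ h.comm
    rwa [map_mul, map_mul, map_mul, hz, mul_one] at this
  have hV : ∀ v : A, v ^ p = 1 → ∃ i j : ℤ, ∃ c ∈ Subgroup.center A,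
      v = ψ x₁ ^ i * ψ x₂ ^ j * c := by
    intro v hv
    obtain ⟨w, hw⟩ := QuotientGroup.mk_surjective (φ.symm (QuotientGroup.mk v))
    have hwp : w ^ p ∈ Subgroup.center A := by
      rw [← QuotientGroup.eq_one_iff, QuotientGroup.mk_pow, hw, ← map_pow, ← QuotientGroup.mk_pow,
        hv, QuotientGroup.mk_one, map_one]
    obtain ⟨i, j, c, hc, rfl⟩ := h.exists_mul_of_pow_mem_center hp hwp
    have h1 : (QuotientGroup.mk (ψ (x₁ ^ i * x₂ ^ j * c)) : A ⧸ Subgroup.center A)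
        = QuotientGroup.mk v := by
      rw [hψ, hw]
      exact φ.apply_symm_apply _
    obtain ⟨d, hd, rfl⟩ := exists_eq_mul_of_mk_eq h1
    refine ⟨i, j, ψ c * d, mul_mem ((hmk c).mpr hc) hd, ?_⟩
    simp only [map_mul, map_zpow, mul_assoc]
  obtain ⟨i, j, c, hc, e₁⟩ := hV x₁ h.pow₁
  obtain ⟨k, l, d, hd, e₂⟩ := hV x₂ h.pow₂
  have h12 : Commute x₁ x₂ := by
    nth_rewrite 1 [e₁]
    nth_rewrite 2 [e₂]
    refine Commute.mul_left ?_ (commute_of_mem_center hc _)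
    refine Commute.mul_right ?_ (commute_of_mem_center hd _).symm
    exact (((Commute.refl _).zpow_zpow i k).mul_right (hcomm.zpow_zpow i l)).mul_left
      ((hcomm.symm.zpow_zpow j k).mul_right ((Commute.refl _).zpow_zpow j l))
  have h5 := h.comm
  rw [h12.eq, left_eq_mul] at h5
  have h6 := (h.comm_zpow_eq_one_iff hp 1).mp (by rw [h5, one_zpow])
  have := Int.le_of_dvd one_pos h6
  have := hp.three_le
  omega

/-- Relative to one lift ψ₀, the conjugation relations forbid changing the first two images. The
third may change by a central ζ' exactly when ζ'^((p-1)p^r) = 1, because the commutator relation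
must persist. -/
theorem card_lifts (h : SchulteBasis p r a b x₁ x₂ x₃) (hp : SchulteParameters p a b)
    (φ : A ⧸ Subgroup.center A →* A ⧸ Subgroup.center A) :
    Nat.card {ψ : A →* A // IsLift φ ψ} = p ^ r := by
  have h3p := hp.three_le
  obtain ⟨ψ₀, hψ₀⟩ := h.exists_isLift hp φ
  have hord : Nat.card (Subgroup.zpowers (x₃ ^ ((p - 1) * p))) = p ^ r := by
    rw [Nat.card_zpowers, orderOf_pow_of_dvd (mul_ne_zero (by omega) (by omega)), h.orderOf_eq,
      pow_succ, mul_comm (p ^ r), ← mul_assoc]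
    · exact Nat.mul_div_cancel_left _ (Nat.mul_pos (by omega) (by omega))
    · rw [h.orderOf_eq, pow_succ, mul_comm (p ^ r), ← mul_assoc]
      exact dvd_mul_right _ _
  rw [← hord]
  have ht₀ := h.toSchulteTriple.map ψ₀
  have hle : Subgroup.zpowers (x₃ ^ ((p - 1) * p)) ≤ Subgroup.center A := by
    rw [Subgroup.zpowers_le, pow_mul]
    exact pow_mem (h.pow_mem_center hp) _
  have huniq : ∀ ψ : A →* A, IsLift φ ψ → ψ x₁ = ψ₀ x₁ ∧ ψ x₂ = ψ₀ x₂ ∧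
      (ψ₀ x₃)⁻¹ * ψ x₃ ∈ Subgroup.zpowers (x₃ ^ ((p - 1) * p)) := by
    intro ψ hψ
    have ht := h.toSchulteTriple.map ψ
    obtain ⟨c₁, hc₁, e₁⟩ := exists_eq_mul_of_mk_eq ((hψ₀ x₁).trans (hψ x₁).symm)
    obtain ⟨c₂, hc₂, e₂⟩ := exists_eq_mul_of_mk_eq ((hψ₀ x₂).trans (hψ x₂).symm)
    obtain ⟨c₃, hc₃, e₃⟩ := exists_eq_mul_of_mk_eq ((hψ₀ x₃).trans (hψ x₃).symm)
    rw [e₁, e₂, e₃] at ht ⊢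
    obtain rfl := eq_one_of_mul_eq_mul_zpow hp.prime hp.not_dvd_sub_one hc₁ hc₃ ht₀.pow₁ ht.pow₁ ht₀.conj₁
      ht.conj₁
    obtain rfl := eq_one_of_mul_eq_mul_zpow hp.prime hp.not_dvd_sub_one' hc₂ hc₃ ht₀.pow₂ ht.pow₂ ht₀.conj₂
      ht.conj₂
    refine ⟨mul_one _, mul_one _, ?_⟩
    rw [inv_mul_cancel_left]
    have h1 := ht.comm
    rw [mul_one, mul_one, ht₀.comm, (commute_of_mem_center hc₃ _).symm.mul_pow,
      mul_right_inj, left_eq_mul] at h1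
    rw [h.center_eq hp] at hc₃
    obtain ⟨t, rfl⟩ := hc₃
    simp only at h1 ⊢
    rw [← zpow_natCast, ← zpow_natCast, ← zpow_mul, ← zpow_mul, h.zpow_eq_one_iff] at h1
    have h2 : (p : ℤ) ∣ t * (p - 1 : ℕ) := by
      have h4 : ((p - 1) * p ^ r : ℕ) ≠ 0 := mul_ne_zero (by omega) (pow_ne_zero _ (by omega))
      have h5 : ((((p - 1) * p ^ r : ℕ) : ℤ) * p) ∣ (((p - 1) * p ^ r : ℕ) : ℤ) * (t * (p - 1 : ℕ)) := by
        convert h1 using 1 <;> push_cast <;> ring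
      exact (mul_dvd_mul_iff_left (by exact_mod_cast h4)).mp h5
    have h3 : (p : ℤ) ∣ t := by
      rcases (Nat.prime_iff_prime_int.mp hp.prime).dvd_or_dvd h2 with h4 | h4
      · exact h4
      · have := Nat.le_of_dvd (by omega) (Int.natCast_dvd_natCast.mp h4)
        omega
    obtain ⟨k, rfl⟩ := h3
    refine ⟨k, ?_⟩
    simp only
    rw [pow_mul, zpow_mul, zpow_natCast]
  refine Nat.card_eq_of_bijective
    (fun ψ => (⟨(ψ₀ x₃)⁻¹ * ψ.1 x₃, (huniq ψ.1 ψ.2).2.2⟩ : Subgroup.zpowers (x₃ ^ ((p - 1) * p))))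
    ⟨?_, ?_⟩
  · rintro ⟨ψ, hψ⟩ ⟨ψ', hψ'⟩ heq
    obtain ⟨h₁, h₂, -⟩ := huniq ψ hψ
    obtain ⟨h₁', h₂', -⟩ := huniq ψ' hψ'
    have h₃ := congrArg Subtype.val heq
    exact Subtype.ext (h.hom_ext (h₁.trans h₁'.symm) (h₂.trans h₂'.symm) (mul_left_cancel h₃))
  · rintro ⟨ζ, hζ⟩
    have hζc := hle hζ
    have hζp : ζ ^ ((p - 1) * p ^ r) = 1 := by
      obtain ⟨t, rfl⟩ := hζ
      simp only
      rw [← zpow_natCast, ← zpow_natCast, ← zpow_mul, ← zpow_mul, h.zpow_eq_one_iff]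
      refine ⟨t * (p - 1 : ℕ), ?_⟩
      push_cast
      ring
    have key : SchulteTriple p r a b (ψ₀ x₁) (ψ₀ x₂) (ψ₀ x₃ * ζ) := by
      refine ⟨ht₀.pow₁, ht₀.pow₂, ?_, ?_, ?_, ?_⟩
      · rw [(commute_of_mem_center hζc _).symm.mul_pow, ht₀.pow₃, pow_succ, ← mul_assoc, pow_mul ζ,
          hζp, one_pow, one_mul]
      · rw [← mul_assoc, ht₀.conj₁, mul_assoc, mul_assoc, (commute_of_mem_center hζc _).eq]
      · rw [← mul_assoc, ht₀.conj₂, mul_assoc, mul_assoc, (commute_of_mem_center hζc _).eq]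
      · rw [(commute_of_mem_center hζc _).symm.mul_pow, hζp, mul_one, ht₀.comm]
    obtain ⟨ψ, h₁, h₂, h₃⟩ := h.exists_hom key
    refine ⟨⟨ψ, IsLift.of_comp_mk' (hψ₀.comp_mk' ▸ h.hom_ext ?_ ?_ ?_)⟩, ?_⟩
    · simp only [MonoidHom.comp_apply, h₁]
    · simp only [MonoidHom.comp_apply, h₂]
    · simp only [MonoidHom.comp_apply, h₃]
      exact mk_mul_eq hζc _
    · apply Subtype.ext
      simp only [h₃, inv_mul_cancel_left]

theorem autQuotient_surjective (h : SchulteBasis p r a b x₁ x₂ x₃)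
    (hp : SchulteParameters p a b) :
    Function.Surjective (autQuotient (Subgroup.center A)) := by
  intro φ
  obtain ⟨ψ, hψ⟩ := h.exists_isLift hp φ.toMonoidHom
  refine ⟨MulEquiv.ofBijective ψ (h.bijective_of_isLift hp hψ), ?_⟩
  ext q
  obtain ⟨g, rfl⟩ := QuotientGroup.mk_surjective q
  exact hψ g

end SchulteBasis

/-! ### From relators to the presented group. -/

theorem schulteTriple_of_lift_eq_one {p r : ℕ} {a b : ℤ} (hp : 1 ≤ p) {B : Type*} [Group B]
    (f : FreeGroup (Fin 3) →* B) (hf : ∀ w ∈ schulteRels p (r + 3) a b 0 0, f w = 1) :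
    SchulteTriple p r a b (f (.of 0)) (f (.of 1)) (f (.of 2)) := by
  simp only [schulteRels, Set.mem_insert_iff, Set.mem_singleton_iff, forall_eq_or_imp, forall_eq,
    map_mul, map_pow, map_zpow, map_inv, zero_mul, zpow_zero, mul_one,
    Nat.add_sub_cancel, show r + 3 - 2 = r + 1 from rfl] at hf
  obtain ⟨h₁, h₂, h₃, h₄, h₅, h₆⟩ := hf
  refine ⟨h₁, h₂, h₃, ?_, ?_, ?_⟩
  · rw [mul_assoc, mul_assoc, zpow_neg, inv_mul_eq_one, eq_inv_mul_iff_mul_eq] at h₄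
    exact h₄.symm
  · rw [mul_assoc, mul_assoc, zpow_neg, inv_mul_eq_one, eq_inv_mul_iff_mul_eq] at h₅
    exact h₅.symm
  · rw [zpow_neg, mul_inv_eq_one, mul_assoc, mul_assoc, inv_mul_eq_iff_eq_mul,
      inv_mul_eq_iff_eq_mul, ← mul_assoc] at h₆
    rw [h₆, ← zpow_natCast]
    congr 2
    push_cast [Nat.cast_sub hp]
    rfl

theorem lift_eq_one_of_schulteTriple {p r : ℕ} {a b : ℤ} (hp : 1 ≤ p) {B : Type*} [Group B]
    (f : FreeGroup (Fin 3) →* B)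
    (h : SchulteTriple p r a b (f (.of 0)) (f (.of 1)) (f (.of 2))) :
    ∀ w ∈ schulteRels p (r + 3) a b 0 0, f w = 1 := by
  simp only [schulteRels, Set.mem_insert_iff, Set.mem_singleton_iff, forall_eq_or_imp, forall_eq,
    map_mul, map_pow, map_zpow, map_inv, zero_mul, zpow_zero, mul_one,
    Nat.add_sub_cancel, show r + 3 - 2 = r + 1 from rfl]
  refine ⟨h.pow₁, h.pow₂, h.pow₃, ?_, ?_, ?_⟩
  · rw [mul_assoc, mul_assoc, zpow_neg, inv_mul_eq_one, eq_inv_mul_iff_mul_eq]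
    exact h.conj₁.symm
  · rw [mul_assoc, mul_assoc, zpow_neg, inv_mul_eq_one, eq_inv_mul_iff_mul_eq]
    exact h.conj₂.symm
  · rw [zpow_neg, mul_inv_eq_one, mul_assoc, mul_assoc, inv_mul_eq_iff_eq_mul,
      inv_mul_eq_iff_eq_mul, ← mul_assoc]
    rw [h.comm, ← zpow_natCast]
    congr 2
    push_cast [Nat.cast_sub hp]
    rfl

/-- A generating triple with unique normal forms that satisfies Schulte's relations identifies the
group with the group given by Schulte's presentation. -/
theorem SchulteTriple.exists_mulEquiv {p r : ℕ} {a b : ℤ} {A : Type} [Group A] {x₁ x₂ x₃ : A}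
    (h : SchulteTriple p r a b x₁ x₂ x₃) (hp : SchulteParameters p a b)
    (hgen : Subgroup.closure {x₁, x₂, x₃} = ⊤)
    (hindep : ∀ u v w : ℤ, x₁ ^ u * x₂ ^ v * x₃ ^ w = 1 →
      (p : ℤ) ∣ u ∧ (p : ℤ) ∣ v ∧ (((p - 1) * p ^ (r + 1) : ℕ) : ℤ) ∣ w) :
    SchulteBasis p r a b x₁ x₂ x₃ ∧
      ∃ e : SchulteGroup p (r + 3) a b 0 0 ≃* A, e (PresentedGroup.of 2) = x₃ := by
  have h1p := hp.prime.one_le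
  have hlift : ∀ {B : Type} [Group B] {y₁ y₂ y₃ : B}, SchulteTriple p r a b y₁ y₂ y₃ →
      ∃ f : SchulteGroup p (r + 3) a b 0 0 →* B, f (.of 0) = y₁ ∧ f (.of 1) = y₂ ∧
        f (.of 2) = y₃ := by
    intro B _ y₁ y₂ y₃ hy
    have hrel : ∀ w ∈ schulteRels p (r + 3) a b 0 0, FreeGroup.lift ![y₁, y₂, y₃] w = 1 :=
      lift_eq_one_of_schulteTriple h1p _ (by simpa using hy)
    exact ⟨PresentedGroup.toGroup hrel, PresentedGroup.toGroup.of _, PresentedGroup.toGroup.of _,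
      PresentedGroup.toGroup.of _⟩
  have hS : SchulteTriple p r a b (.of 0 : SchulteGroup p (r + 3) a b 0 0) (.of 1) (.of 2) :=
    schulteTriple_of_lift_eq_one h1p (PresentedGroup.mk _)
      (fun w hw => PresentedGroup.one_of_mem hw)
  have hSgen : ∀ g : SchulteGroup p (r + 3) a b 0 0, g ∈ Subgroup.closure
      {(.of 0 : SchulteGroup p (r + 3) a b 0 0), .of 1, .of 2} := by
    apply PresentedGroup.generated_by
    intro j
    apply Subgroup.subset_closure
    fin_cases j <;> simp
  obtain ⟨f, hf₁, hf₂, hf₃⟩ := hlift h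
  have hf : Function.Bijective f := by
    constructor
    · rw [injective_iff_map_eq_one]
      intro g hg
      -- The relations alone give normal forms upstairs, and independence downstairs makes their
      -- exponents vanish.
      obtain ⟨u, v, w, rfl⟩ := hS.exists_eq_of_mem_closure hp (hSgen g)
      simp only [map_mul, map_zpow, hf₁, hf₂, hf₃] at hg
      obtain ⟨hu, hv, hw⟩ := hindep u v w hg
      rw [zpow_eq_one_of_dvd hS.pow₁ hu, zpow_eq_one_of_dvd hS.pow₂ hv,
        zpow_eq_one_of_dvd hS.pow₃ hw, one_mul, one_mul]
    · rw [← MonoidHom.range_eq_top, ← top_le_iff, ← hgen, Subgroup.closure_le]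
      rintro x (rfl | rfl | rfl)
      · exact ⟨_, hf₁⟩
      · exact ⟨_, hf₂⟩
      · exact ⟨_, hf₃⟩
  let e := MulEquiv.ofBijective f hf
  refine ⟨⟨h, fun g => h.exists_eq_of_mem_closure hp (by rw [hgen]; exact Subgroup.mem_top g),
    hindep, ?_⟩, e, hf₃⟩
  intro B _ y₁ y₂ y₃ hy
  obtain ⟨f', h₁, h₂, h₃⟩ := hlift hy
  refine ⟨f'.comp e.symm.toMonoidHom, ?_, ?_, ?_⟩
  · rw [← h₁]
    exact congrArg f' (e.symm_apply_eq.mpr hf₁.symm)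
  · rw [← h₂]
    exact congrArg f' (e.symm_apply_eq.mpr hf₂.symm)
  · rw [← h₃]
    exact congrArg f' (e.symm_apply_eq.mpr hf₃.symm)

/-! ### Primitive roots modulo powers of p. -/

namespace SchulteParameters

variable {p : ℕ} {a b : ℤ}

/-- An integer that is primitive modulo `p` is congruent to a primitive root modulo any power
of `p`. -/
theorem exists_primitiveRoot (h : SchulteParameters p a b) (s : ℕ) :
    ∃ g : ℕ, (g : ℤ) ≡ a [ZMOD (p : ℤ)] ∧
      (∀ k : ℕ, (g : ℤ) ^ k ≡ 1 [ZMOD ((p ^ (s + 1) : ℕ) : ℤ)] ↔ (p - 1) * p ^ s ∣ k) ∧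
      ∀ i : ℤ, ¬ (p : ℤ) ∣ i → ∃ k : ℕ, (g : ℤ) ^ k ≡ i [ZMOD ((p ^ (s + 1) : ℕ) : ℤ)] := by
  have hp := h.prime
  have h3 := h.three_le
  have hpr := Nat.prime_iff_prime_int.mp hp
  have : Fact p.Prime := ⟨hp⟩
  have : NeZero (p ^ (s + 1)) := ⟨pow_ne_zero _ hp.ne_zero⟩
  have hcyc : IsCyclic (ZMod (p ^ (s + 1)))ˣ :=
    ZMod.isCyclic_units_of_prime_pow p hp h.ne_two (s + 1)
  have hcard : Nat.card (ZMod (p ^ (s + 1)))ˣ = (p - 1) * p ^ s := by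
    rw [Nat.card_eq_fintype_card, ZMod.card_units_eq_totient, Nat.totient_prime_pow_succ hp,
      mul_comm]
  obtain ⟨γ, hγ⟩ := hcyc.exists_generator
  have hγo : orderOf γ = (p - 1) * p ^ s := by
    rw [orderOf_eq_card_of_forall_mem_zpowers hγ, hcard]
  have hγp : ∀ x, x ∈ Submonoid.powers γ := fun x => mem_powers_iff_mem_zpowers.mpr (hγ x)
  have hd : p ∣ p ^ (s + 1) := dvd_pow_self p (Nat.succ_ne_zero s)
  -- the class of `a` modulo `p`
  have haz : (a : ZMod p) ≠ 0 := by
    rw [Ne, ZMod.intCast_zmod_eq_zero_iff_dvd]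
    exact h.not_dvd_left
  let α : (ZMod p)ˣ := Units.mk0 (a : ZMod p) haz
  have hα : p - 1 ∣ orderOf α := by
    apply h.primitive
    rw [← ZMod.intCast_eq_intCast_iff]
    rw [Int.cast_pow, Int.cast_one]
    exact congrArg Units.val (pow_orderOf_eq_one α)
  obtain ⟨x, hx⟩ := ZMod.unitsMap_surjective hd α
  obtain ⟨k, rfl⟩ := hγp x
  simp only [map_pow] at hx
  set δ := ZMod.unitsMap hd γ with hδ
  have hδo : δ ^ (p - 1) = 1 := ZMod.units_pow_card_sub_one_eq_one p δ
  have hk : Nat.Coprime k (p - 1) := by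
    rw [Nat.coprime_comm, Nat.coprime_iff_gcd_eq_one]
    have h1 : α ^ ((p - 1) / Nat.gcd (p - 1) k) = 1 := by
      rw [← hx, ← pow_mul, ← Nat.mul_div_assoc _ (Nat.gcd_dvd_left _ _), mul_comm,
        Nat.mul_div_assoc _ (Nat.gcd_dvd_right _ _), pow_mul, hδo, one_pow]
    have h2 := hα.trans (orderOf_dvd_of_pow_eq_one h1)
    have h4 : 0 < p - 1 := by omega
    have h5 := Nat.gcd_pos_of_pos_left k h4
    have h6 := Nat.le_of_dvd (Nat.div_pos (Nat.gcd_le_left _ h4) h5) h2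
    by_contra hne
    have := Nat.div_lt_self h4 (show 1 < Nat.gcd (p - 1) k by omega)
    omega
  -- The exponent matters only modulo p - 1 for the residue modulo p. If p ∣ k, adding p - 1 makes
  -- it prime to p.
  obtain ⟨k', hk', hk'p⟩ : ∃ k', Nat.Coprime k' ((p - 1) * p ^ s) ∧ δ ^ k' = δ ^ k := by
    by_cases hpk : p ∣ k
    · refine ⟨k + (p - 1), Nat.Coprime.mul_right (by simpa using hk) ?_, ?_⟩
      · apply Nat.Coprime.pow_right
        rw [Nat.coprime_comm, hp.coprime_iff_not_dvd, Nat.dvd_add_right hpk]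
        intro h7
        have := Nat.le_of_dvd (by omega) h7
        omega
      · rw [pow_add, hδo, mul_one]
    · refine ⟨k, Nat.Coprime.mul_right hk ?_, rfl⟩
      apply Nat.Coprime.pow_right
      rwa [Nat.coprime_comm, hp.coprime_iff_not_dvd]
  have hgo : orderOf (γ ^ k') = (p - 1) * p ^ s := by
    rw [Nat.Coprime.orderOf_pow (by rw [hγo]; exact hk'.symm), hγo]
  have hcast : ((((γ ^ k' : (ZMod (p ^ (s + 1)))ˣ) : ZMod (p ^ (s + 1))).val : ℕ) :
      ZMod (p ^ (s + 1))) = ((γ ^ k' : (ZMod (p ^ (s + 1)))ˣ) : ZMod (p ^ (s + 1))) :=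
    ZMod.natCast_zmod_val _
  refine ⟨((γ ^ k' : (ZMod (p ^ (s + 1)))ˣ) : ZMod (p ^ (s + 1))).val, ?_, ?_, ?_⟩
  · rw [← ZMod.intCast_eq_intCast_iff]
    have h8 := congrArg Units.val (hk'p.trans hx)
    rw [hδ, ← map_pow, ZMod.unitsMap_val] at h8
    rw [Int.cast_natCast, ZMod.natCast_val]
    exact h8
  · intro j
    rw [← ZMod.intCast_eq_intCast_iff]
    rw [Int.cast_pow, Int.cast_one, Int.cast_natCast, hcast, ← hgo, orderOf_dvd_iff_pow_eq_one,
      ← Units.val_inj, Units.val_pow_eq_pow_val (γ ^ k'), Units.val_one]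
  · intro i hi
    have hiu : IsUnit (i : ZMod (p ^ (s + 1))) := by
      rw [ZMod.coe_int_isUnit_iff_isCoprime]
      push_cast
      exact (hpr.coprime_iff_not_dvd.mpr hi).pow_left
    obtain ⟨ι, hι⟩ := hiu
    have h9 : ι ∈ Subgroup.zpowers (γ ^ k') := by
      have : Subgroup.zpowers (γ ^ k') = ⊤ := by
        apply Subgroup.eq_top_of_card_eq
        rw [Nat.card_zpowers, hgo, hcard]
      rw [this]
      exact Subgroup.mem_top _
    obtain ⟨j, hj⟩ := mem_powers_iff_mem_zpowers.mpr h9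
    refine ⟨j, ?_⟩
    rw [← ZMod.intCast_eq_intCast_iff]
    rw [Int.cast_pow, Int.cast_natCast, hcast, ← hι, ← hj]
    rfl

/-- The parameters of the main theorem satisfy `SchulteParameters`. -/
theorem of_generator {r : ℕ} (hp : p.Prime) (hp2 : p ≠ 2)
    (ha : ∃ u : (ZMod (p ^ (r + 1)))ˣ,
      (u : ZMod (p ^ (r + 1))) = (a : ZMod (p ^ (r + 1))) ∧ Subgroup.zpowers u = ⊤)
    (hb : a * b ≡ 1 [ZMOD (p : ℤ)]) : SchulteParameters p a b where
  prime := hp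
  ne_two := hp2
  mul_modEq := hb
  primitive := by
    intro k hk
    obtain ⟨u, hu, hgen⟩ := ha
    have : Fact p.Prime := ⟨hp⟩
    have : NeZero (p ^ (r + 1)) := ⟨pow_ne_zero _ hp.ne_zero⟩
    have hd : p ∣ p ^ (r + 1) := dvd_pow_self p (Nat.succ_ne_zero r)
    have h1 : ((ZMod.unitsMap hd u : (ZMod p)ˣ) : ZMod p) = a := by
      rw [ZMod.unitsMap_val, hu, ZMod.cast_intCast hd]
    have h2 : Subgroup.zpowers (ZMod.unitsMap hd u) = ⊤ := by
      rw [← MonoidHom.map_zpowers, hgen, ← MonoidHom.range_eq_map, MonoidHom.range_eq_top]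
      exact ZMod.unitsMap_surjective hd
    have h3 : orderOf (ZMod.unitsMap hd u) = p - 1 := by
      rw [← Nat.card_zpowers, h2, Subgroup.card_top, Nat.card_eq_fintype_card, ZMod.card_units]
    rw [← h3, orderOf_dvd_iff_pow_eq_one, ← Units.val_inj]
    push_cast
    rw [h1]
    have := (ZMod.intCast_eq_intCast_iff _ _ _).mpr hk
    push_cast at this
    exact this

end SchulteParameters

/-! ### The metacyclic group and its automorphisms. -/

/-- A pair of elements satisfying the relations of the metacyclic group with `n = r + 3`. -/
structure MetacyclicPair (p r : ℕ) {G : Type*} [Group G] (x y : G) : Prop where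
  pow_x : x ^ p ^ (r + 2) = 1
  pow_y : y ^ p = 1
  comm : x * y = y * x * x ^ p ^ (r + 1)

namespace MetacyclicPair

variable {p r : ℕ} {G : Type*} [Group G] {x y : G}

theorem pow_comm (h : MetacyclicPair p r x y) : (x ^ p ^ (r + 1)) ^ p = 1 := by
  rw [← pow_mul, ← pow_succ, h.pow_x]

theorem commute_x (x : G) (k : ℕ) : Commute (x ^ k) x :=
  Commute.pow_self x k

/-- Conjugation by y raises c = x^(p^(r+1)) to the power 1 + p^(r+1), and p^(r+2) divides
p^(2(r+1)). -/
theorem commute_y (h : MetacyclicPair p r x y) : Commute (x ^ p ^ (r + 1)) y := by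
  have h1 : x * y = y * x ^ (1 + (p ^ (r + 1) : ℕ) : ℤ) := by
    rw [h.comm, zpow_add, zpow_one, zpow_natCast, mul_assoc]
  have h2 := mul_pow_of_mul_eq h1 1 (p ^ (r + 1) : ℕ)
  rw [pow_one, pow_one] at h2
  have h3 : x ^ ((1 + (p ^ (r + 1) : ℕ)) * (p ^ (r + 1) : ℕ) : ℤ) = x ^ ((p ^ (r + 1) : ℕ) : ℤ) := by
    apply zpow_eq_zpow_of_modEq h.pow_x
    rw [Int.modEq_iff_dvd]
    refine ⟨-(p ^ r : ℕ), ?_⟩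
    push_cast
    ring
  rwa [h3, zpow_natCast] at h2

theorem commute_zpow_mul_zpow (h : MetacyclicPair p r x y) (s i j : ℤ) :
    Commute ((x ^ p ^ (r + 1)) ^ s) (x ^ i * y ^ j) :=
  ((commute_x x _).zpow_zpow s i).mul_right (h.commute_y.zpow_zpow s j)

theorem zpow_mul_zpow (h : MetacyclicPair p r x y) (i j : ℤ) :
    x ^ i * y ^ j = y ^ j * x ^ i * (x ^ p ^ (r + 1)) ^ (i * j) :=
  zpow_mul_zpow_of_commutator h.comm (commute_x x _) h.commute_y i j

theorem mul_zpow_pow (h : MetacyclicPair p r x y) (i j : ℤ) (k : ℕ) :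
    (x ^ i * y ^ j) ^ k =
      x ^ (i * k) * y ^ (j * k) * (x ^ p ^ (r + 1)) ^ (-(i * j * k.choose 2)) := by
  rw [mul_pow_of_commutator (h.zpow_mul_zpow i j) ((commute_x x _).zpow_zpow _ _)
    (h.commute_y.zpow_zpow _ _), ← zpow_natCast, ← zpow_natCast, ← zpow_mul, ← zpow_mul,
    ← zpow_mul, mul_neg]

theorem dvd_choose_two (hp : p.Prime) (hp2 : p ≠ 2) {s : ℕ} (hs : p ∣ s) : p ∣ s.choose 2 := by
  have h1 : p ∣ s.choose 2 * 2 := by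
    rw [Nat.choose_two_right, Nat.div_mul_cancel (Nat.even_mul_pred_self s).two_dvd]
    exact hs.mul_right _
  exact (hp.dvd_mul.mp h1).resolve_right
    fun h2 => hp2 ((Nat.prime_dvd_prime_iff_eq hp Nat.prime_two).mp h2)

/-- For odd p the y-part and the commutator term both die. This computes the image of c and the
elements of order p. -/
theorem mul_zpow_pow_prime_pow (h : MetacyclicPair p r x y) (hp : p.Prime) (hp2 : p ≠ 2)
    (i j : ℤ) (s : ℕ) : (x ^ i * y ^ j) ^ p ^ (s + 1) = (x ^ p ^ (s + 1)) ^ i := by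
  have hd : p ∣ p ^ (s + 1) := dvd_pow_self p (Nat.succ_ne_zero s)
  rw [h.mul_zpow_pow, zpow_eq_one_of_dvd h.pow_y
    ((Int.natCast_dvd_natCast.mpr hd).mul_left j), zpow_eq_one_of_dvd h.pow_comm
    ((dvd_neg.mpr ((Int.natCast_dvd_natCast.mpr (dvd_choose_two hp hp2 hd)).mul_left _))),
    mul_one, mul_one, mul_comm, zpow_mul, zpow_natCast]

/-- The possible images of the generators under an endomorphism satisfy the same relations. -/
theorem image (h : MetacyclicPair p r x y) (hp : p.Prime) (hp2 : p ≠ 2) (i j k : ℤ) :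
    MetacyclicPair p r (x ^ i * y ^ j) ((x ^ p ^ (r + 1)) ^ k * y) := by
  refine ⟨?_, ?_, ?_⟩
  · rw [h.mul_zpow_pow_prime_pow hp hp2, h.pow_x, one_zpow]
  · rw [(h.commute_y.zpow_left k).mul_pow, h.pow_y, mul_one, ← zpow_natCast, ← zpow_mul]
    exact zpow_eq_one_of_dvd h.pow_comm (dvd_mul_left _ _)
  · rw [h.mul_zpow_pow_prime_pow hp hp2]
    have h1 := h.zpow_mul_zpow i 1
    rw [zpow_one, mul_one] at h1
    have h2 := h.commute_zpow_mul_zpow k i j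
    have h3 := (h.commute_y.zpow_left i).zpow_right j
    calc x ^ i * y ^ j * ((x ^ p ^ (r + 1)) ^ k * y)
        = (x ^ p ^ (r + 1)) ^ k * (x ^ i * (y ^ j * y)) := by
          rw [← mul_assoc, ← h2.eq]; simp only [mul_assoc]
      _ = (x ^ p ^ (r + 1)) ^ k * (x ^ i * y * y ^ j) := by
          rw [(Commute.zpow_self y j).eq, mul_assoc (x ^ i)]
      _ = (x ^ p ^ (r + 1)) ^ k * (y * x ^ i * (y ^ j * (x ^ p ^ (r + 1)) ^ i)) := by
          rw [h1, mul_assoc (y * x ^ i), h3.eq]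
      _ = _ := by simp only [mul_assoc]

end MetacyclicPair

/-- A pair of generators of a metacyclic group presented by the relations, with unique normal
forms `x ^ i * y ^ j`. -/
structure MetacyclicBasis (p r : ℕ) {G : Type} [Group G] (x y : G) : Prop
    extends MetacyclicPair p r x y where
  exists_eq : ∀ g : G, ∃ i j : ℤ, g = x ^ i * y ^ j
  indep : ∀ i j : ℤ, x ^ i * y ^ j = 1 → ((p ^ (r + 2) : ℕ) : ℤ) ∣ i ∧ (p : ℤ) ∣ j
  exists_hom : ∀ {B : Type} [Group B] {x' y' : B}, MetacyclicPair p r x' y' →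
    ∃ f : G →* B, f x = x' ∧ f y = y'

namespace MetacyclicBasis

variable {p r : ℕ} {G : Type} [Group G] {x y : G}

theorem mulAut_ext (h : MetacyclicBasis p r x y) {f g : MulAut G} (hx : f x = g x)
    (hy : f y = g y) : f = g := by
  ext z
  obtain ⟨i, j, rfl⟩ := h.exists_eq z
  simp only [map_mul, map_zpow, hx, hy]

theorem finite (h : MetacyclicBasis p r x y) (hp : p.Prime) : Finite G := by
  have hf : ∀ {x : G} {k : ℕ}, 0 < k → x ^ k = 1 → (Subgroup.zpowers x : Set G).Finite := by
    intro x k hk hx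
    exact (isOfFinOrder_iff_pow_eq_one.mpr ⟨k, hk, hx⟩).finite_zpowers
  rw [← Set.finite_univ_iff]
  refine ((hf (pow_pos hp.pos _) h.pow_x).mul (hf hp.pos h.pow_y)).subset fun g _ => ?_
  obtain ⟨u, v, rfl⟩ := h.exists_eq g
  exact Set.mul_mem_mul ⟨u, rfl⟩ ⟨v, rfl⟩

theorem zpow_eq_one_iff (h : MetacyclicBasis p r x y) (i : ℤ) :
    x ^ i = 1 ↔ ((p ^ (r + 2) : ℕ) : ℤ) ∣ i :=
  ⟨fun hi => (h.indep i 0 (by simpa using hi)).1, zpow_eq_one_of_dvd h.pow_x⟩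

theorem comm_zpow_eq_one_iff (h : MetacyclicBasis p r x y) (hp : p.Prime) (s : ℤ) :
    (x ^ p ^ (r + 1)) ^ s = 1 ↔ (p : ℤ) ∣ s := by
  rw [← zpow_natCast, ← zpow_mul, h.zpow_eq_one_iff, pow_succ]
  push_cast
  exact mul_dvd_mul_iff_left (pow_ne_zero _ (by exact_mod_cast hp.ne_zero))

theorem commute (h : MetacyclicBasis p r x y) (s : ℤ) (g : G) :
    Commute ((x ^ p ^ (r + 1)) ^ s) g := by
  obtain ⟨i, j, rfl⟩ := h.exists_eq g
  exact h.commute_zpow_mul_zpow s i j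

/-- Existence of automorphisms with prescribed values on the generators. -/
theorem exists_mulAut (h : MetacyclicBasis p r x y) (hp : p.Prime) (hp2 : p ≠ 2) {i : ℤ}
    (hi : ¬ (p : ℤ) ∣ i) (j k : ℤ) :
    ∃ f : MulAut G, f x = x ^ i * y ^ j ∧ f y = (x ^ p ^ (r + 1)) ^ k * y := by
  obtain ⟨f, hfx, hfy⟩ := h.exists_hom (h.image hp hp2 i j k)
  have hcop := (Nat.prime_iff_prime_int.mp hp).coprime_iff_not_dvd.mpr hi
  -- Surjectivity: the range contains c^i, hence c as p ∤ i, then y, then x^i, then x.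
  have hc : (x ^ p ^ (r + 1)) ^ i ∈ f.range :=
    ⟨x ^ p ^ (r + 1), by rw [map_pow, hfx, h.mul_zpow_pow_prime_pow hp hp2]⟩
  have hc' : x ^ p ^ (r + 1) ∈ f.range := by
    obtain ⟨u, v, huv⟩ := hcop
    have := zpow_mem hc v
    rw [← zpow_mul] at this
    rw [← zpow_one (x ^ p ^ (r + 1)), ← huv, zpow_add, mul_comm v, zpow_eq_one_of_dvd h.pow_comm
      (dvd_mul_left _ u), one_mul]
    exact this
  have hy : y ∈ f.range := by
    rw [← inv_mul_cancel_left ((x ^ p ^ (r + 1)) ^ k) y]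
    exact mul_mem (inv_mem (zpow_mem hc' k)) ⟨y, hfy⟩
  have hx : x ∈ f.range := by
    obtain ⟨u, v, huv⟩ := hcop.pow_left (m := r + 2)
    have h1 : x ^ i ∈ f.range := by
      rw [← mul_inv_cancel_right (x ^ i) (y ^ j)]
      exact mul_mem ⟨x, hfx⟩ (inv_mem (zpow_mem hy j))
    have h2 := zpow_mem h1 v
    rw [← zpow_mul] at h2
    rw [← zpow_one x, ← huv, zpow_add, mul_comm v, zpow_eq_one_of_dvd h.pow_x
      (by push_cast; exact dvd_mul_left _ u), one_mul]
    exact h2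
  have hsurj : Function.Surjective f := by
    intro g
    obtain ⟨i, j, rfl⟩ := h.exists_eq g
    exact mul_mem (zpow_mem hx i) (zpow_mem hy j)
  have := h.finite hp
  exact ⟨MulEquiv.ofBijective f (Finite.surjective_iff_bijective.mp hsurj), hfx, hfy⟩

/-- The values of an automorphism on the generators. -/
theorem mulAut_apply (h : MetacyclicBasis p r x y) (hp : p.Prime) (hp2 : p ≠ 2) (f : MulAut G) :
    ∃ i j k : ℤ, ¬ (p : ℤ) ∣ i ∧ f x = x ^ i * y ^ j ∧ f y = (x ^ p ^ (r + 1)) ^ k * y := by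
  have hpr := Nat.prime_iff_prime_int.mp hp
  obtain ⟨i, j, hfx⟩ := h.exists_eq (f x)
  obtain ⟨k, l, hfy⟩ := h.exists_eq (f y)
  have hc : f (x ^ p ^ (r + 1)) = (x ^ p ^ (r + 1)) ^ i := by
    rw [map_pow, hfx, h.mul_zpow_pow_prime_pow hp hp2]
  have hi : ¬ (p : ℤ) ∣ i := by
    intro hd
    rw [(h.comm_zpow_eq_one_iff hp i).mpr hd, ← map_one f, f.injective.eq_iff] at hc
    have := (h.comm_zpow_eq_one_iff hp 1).mp (by rw [hc, one_zpow])
    have := Int.le_of_dvd one_pos this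
    have := hp.two_le
    omega
  have hk : ((p ^ (r + 1) : ℕ) : ℤ) ∣ k := by
    have h1 := congrArg f h.pow_y
    have h2 := h.mul_zpow_pow_prime_pow hp hp2 k l 0
    rw [zero_add, pow_one] at h2
    rw [map_one, map_pow, hfy, h2, ← zpow_natCast, ← zpow_mul, h.zpow_eq_one_iff, pow_succ',
      Nat.cast_mul] at h1
    exact (mul_dvd_mul_iff_left (by exact_mod_cast hp.ne_zero)).mp h1
  obtain ⟨k, rfl⟩ := hk
  rw [zpow_mul, zpow_natCast] at hfy
  refine ⟨i, j, k, hi, hfx, ?_⟩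
  -- The image of the commutator relation reads c^(il) = c^i, so l ≡ 1 mod p.
  have h1 := congrArg f h.comm
  rw [map_mul, map_mul, map_mul, hc, hfx, hfy] at h1
  have e₁ : x ^ i * y ^ j * ((x ^ p ^ (r + 1)) ^ k * y ^ l)
      = (x ^ p ^ (r + 1)) ^ k * y ^ l * (x ^ i * y ^ j) * (x ^ p ^ (r + 1)) ^ (i * l) := by
    calc x ^ i * y ^ j * ((x ^ p ^ (r + 1)) ^ k * y ^ l)
        = (x ^ p ^ (r + 1)) ^ k * (x ^ i * (y ^ j * y ^ l)) := by
          rw [← mul_assoc, ← (h.commute k _).eq]; simp only [mul_assoc]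
      _ = (x ^ p ^ (r + 1)) ^ k * (x ^ i * y ^ l * y ^ j) := by
          rw [(Commute.zpow_zpow_self y j l).eq, mul_assoc (x ^ i)]
      _ = (x ^ p ^ (r + 1)) ^ k * (y ^ l * x ^ i * (y ^ j * (x ^ p ^ (r + 1)) ^ (i * l))) := by
          rw [h.zpow_mul_zpow i l, mul_assoc (y ^ l * x ^ i), (h.commute (i * l) _).eq]
      _ = _ := by simp only [mul_assoc]
  rw [e₁, mul_right_inj] at h1
  have h2 : (x ^ p ^ (r + 1)) ^ (i * (l - 1)) = 1 := by
    rw [mul_sub, zpow_sub, h1, mul_one, mul_inv_cancel]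
  rw [h.comm_zpow_eq_one_iff hp] at h2
  have h3 := (hpr.dvd_or_dvd h2).resolve_left hi
  rw [hfy]
  congr 1
  rw [zpow_eq_zpow_of_modEq h.pow_y (Int.modEq_iff_dvd.mpr h3).symm, zpow_one]

end MetacyclicBasis

/-! ### Schulte's generators inside the automorphism group. -/

theorem two_mul_choose_two (k : ℕ) : (2 * (k.choose 2 : ℕ) : ℤ) = k * (k - 1) := by
  induction k with
  | zero => simp
  | succ k ih =>
    rw [Nat.choose_succ_succ' k 1, Nat.choose_one_right]
    push_cast
    linarith

theorem SchulteParameters.exists_eq_one_add {p : ℕ} {a b : ℤ} (h : SchulteParameters p a b)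
    {r g : ℕ} (hga : (g : ℤ) ≡ a [ZMOD (p : ℤ)])
    (hg : ∀ k : ℕ, (g : ℤ) ^ k ≡ 1 [ZMOD ((p ^ (r + 1 + 1) : ℕ) : ℤ)] ↔
      (p - 1) * p ^ (r + 1) ∣ k) :
    ∃ s : ℤ, ¬ (p : ℤ) ∣ s ∧ (g : ℤ) ^ ((p - 1) * p ^ r) = 1 + (p ^ (r + 1) : ℕ) * s := by
  have h3 := h.three_le
  have hcop : IsCoprime (g : ℤ) ((p ^ (r + 1) : ℕ) : ℤ) := by
    push_cast
    apply IsCoprime.pow_right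
    rw [isCoprime_comm, (Nat.prime_iff_prime_int.mp h.prime).coprime_iff_not_dvd,
      ← Int.modEq_zero_iff_dvd]
    exact fun h0 => h.not_dvd_left (Int.modEq_zero_iff_dvd.mp (hga.symm.trans h0))
  have h1 : (g : ℤ) ^ ((p - 1) * p ^ r) ≡ 1 [ZMOD ((p ^ (r + 1) : ℕ) : ℤ)] := by
    have h2 := Nat.ModEq.pow_totient (Nat.isCoprime_iff_coprime.mp hcop)
    rw [Nat.totient_prime_pow_succ h.prime, mul_comm] at h2
    exact_mod_cast Int.natCast_modEq_iff.mpr h2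
  obtain ⟨s, hs⟩ := Int.modEq_iff_dvd.mp h1.symm
  refine ⟨s, fun ⟨t, ht⟩ => ?_, by linarith⟩
  have h2 := (hg ((p - 1) * p ^ r)).mp (by
    apply Int.ModEq.symm
    rw [Int.modEq_iff_dvd]
    refine ⟨t, ?_⟩
    rw [hs, ht]
    push_cast
    ring)
  have h4 : 0 < (p - 1) * p ^ r := Nat.mul_pos (by omega) (pow_pos (by omega) _)
  rw [pow_succ, ← mul_assoc] at h2
  have h5 := Nat.le_of_dvd h4 h2
  nlinarith

namespace MetacyclicBasis

variable {p r : ℕ} {G : Type} [Group G] {x y : G} {a b : ℤ}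

theorem mul_comm_zpow (h : MetacyclicBasis p r x y) (i j s : ℤ) :
    x ^ i * y ^ j * (x ^ p ^ (r + 1)) ^ s = x ^ (i + (p ^ (r + 1) : ℕ) * s) * y ^ j := by
  rw [mul_assoc, ← (h.commute s _).eq, ← mul_assoc, zpow_add, zpow_mul, zpow_natCast]

/-- The automorphisms `x ↦ x ^ (1 + p ^ (r + 1) * (q * u)) * y ^ u`, `y ↦ y`. -/
theorem exists_transvections (h : MetacyclicBasis p r x y) (hp : p.Prime) (hp2 : p ≠ 2) (q : ℤ) :
    ∃ B : ℤ → MulAut G, (∀ u, B u x = x ^ (1 + (p ^ (r + 1) : ℕ) * (q * u)) * y ^ u) ∧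
      (∀ u, B u y = y) ∧ (∀ u, B u (x ^ p ^ (r + 1)) = x ^ p ^ (r + 1)) ∧
      ∀ u v, B (u + v) = B u * B v := by
  have hi : ∀ u : ℤ, ¬ (p : ℤ) ∣ 1 + (p ^ (r + 1) : ℕ) * (q * u) := by
    intro u hd
    have h1 : (p : ℤ) ∣ (p ^ (r + 1) : ℕ) * (q * u) :=
      (Int.natCast_dvd_natCast.mpr (dvd_pow_self p (Nat.succ_ne_zero r))).mul_right _
    have h2 := Int.le_of_dvd one_pos ((dvd_add_left h1).mp hd)
    have := hp.two_le
    omega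
  choose B hBx hBy using fun u : ℤ => h.exists_mulAut hp hp2 (hi u) u 0
  simp only [zpow_zero, one_mul] at hBy
  have hBc : ∀ u, B u (x ^ p ^ (r + 1)) = x ^ p ^ (r + 1) := by
    intro u
    rw [map_pow, hBx, h.mul_zpow_pow_prime_pow hp hp2]
    conv_rhs => rw [← zpow_one (x ^ p ^ (r + 1))]
    apply zpow_eq_zpow_of_modEq h.pow_comm
    rw [Int.modEq_iff_dvd]
    refine ⟨-((p ^ r : ℕ) * (q * u)), ?_⟩
    push_cast
    ring
  refine ⟨B, hBx, hBy, hBc, fun u v => h.mulAut_ext ?_ ?_⟩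
  · rw [MulAut.mul_apply, hBx v, map_mul, map_zpow (B u) y, hBy, zpow_add, zpow_one, zpow_mul,
      zpow_natCast, map_mul, map_zpow, hBc, mul_assoc _ _ (y ^ v), (h.commute _ (y ^ v)).eq,
      ← mul_assoc, hBx, hBx, mul_assoc _ (y ^ u), ← zpow_add, h.mul_comm_zpow]
    congr 2
    ring
  · rw [MulAut.mul_apply, hBy, hBy, hBy]

/-- The automorphisms `x ↦ x`, `y ↦ x ^ (p ^ (r + 1) * v) * y`. -/
theorem exists_shears (h : MetacyclicBasis p r x y) (hp : p.Prime) (hp2 : p ≠ 2) :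
    ∃ C : ℤ → MulAut G, (∀ v, C v x = x) ∧ (∀ v, C v y = (x ^ p ^ (r + 1)) ^ v * y) ∧
      ∀ u v, C (u + v) = C u * C v := by
  have hi : ¬ (p : ℤ) ∣ 1 := by
    intro hd
    have h2 := Int.le_of_dvd one_pos hd
    have := hp.two_le
    omega
  choose C hCx hCy using fun v : ℤ => h.exists_mulAut hp hp2 hi 0 v
  simp only [zpow_zero, zpow_one, mul_one] at hCx
  refine ⟨C, hCx, hCy, fun u v => h.mulAut_ext ?_ ?_⟩
  · rw [MulAut.mul_apply, hCx, hCx, hCx]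
  · rw [MulAut.mul_apply, hCy, hCy, map_mul, map_zpow, map_pow, hCx, hCy, ← mul_assoc,
      ← zpow_add, add_comm u v]

/-- The automorphism group of the metacyclic group has a generating triple that satisfies
Schulte's relations and has unique normal forms. -/
theorem exists_schulteTriple (h : MetacyclicBasis p r x y) (hs : SchulteParameters p a b) :
    ∃ x₁ x₂ x₃ : MulAut G, SchulteTriple p r a b x₁ x₂ x₃ ∧
      Subgroup.closure {x₁, x₂, x₃} = ⊤ ∧
      ∀ u v w : ℤ, x₁ ^ u * x₂ ^ v * x₃ ^ w = 1 →
        (p : ℤ) ∣ u ∧ (p : ℤ) ∣ v ∧ (((p - 1) * p ^ (r + 1) : ℕ) : ℤ) ∣ w := by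
  have hp := hs.prime
  have hp2 := hs.ne_two
  have h3 := hs.three_le
  have hpr := Nat.prime_iff_prime_int.mp hp
  obtain ⟨g, hga, hgo, hgen⟩ := hs.exists_primitiveRoot (r + 1)
  have hgp : ¬ (p : ℤ) ∣ g := by
    rw [← Int.modEq_zero_iff_dvd]
    exact fun h0 => hs.not_dvd_left (Int.modEq_zero_iff_dvd.mp (hga.symm.trans h0))
  obtain ⟨s, hsp, hgs⟩ := hs.exists_eq_one_add hga hgo
  -- As p = 2q + 1, q ≡ -1/2 mod p. This twist in `B` cancels the binomial term of the g-th power,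
  -- so `B 1 * S = S * B 1 ^ a` holds without central error.
  obtain ⟨q, hq⟩ := hp.odd_of_ne_two hp2
  obtain ⟨B, hBx, hBy, hBc, hBadd⟩ := h.exists_transvections hp hp2 q
  obtain ⟨C, hCx, hCy, hCadd⟩ := h.exists_shears hp hp2
  obtain ⟨S, hSx, hSy⟩ := h.exists_mulAut hp hp2 hgp 0 0
  simp only [zpow_zero, mul_one, one_mul] at hSx hSy
  have hBpow := zpow_eq_of_map_add hBadd
  -- The parameter -s is chosen because S^((p-1)p^r) sends x to x c^s, and this factor must cancel
  -- in the commutator relation.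
  have hCpow : ∀ v, C (-s) ^ v = C (-s * v) := by
    intro v
    rw [← zpow_eq_of_map_add hCadd (-s), ← zpow_mul, zpow_eq_of_map_add hCadd]
  have hBp : B 1 ^ p = 1 := by
    apply h.mulAut_ext
    · rw [← zpow_natCast, hBpow, hBx, zpow_natCast, h.pow_y, mul_one, MulAut.one_apply]
      conv_rhs => rw [← zpow_one x]
      apply zpow_eq_zpow_of_modEq h.pow_x
      rw [Int.modEq_iff_dvd]
      refine ⟨-q, ?_⟩
      push_cast
      ring
    · rw [← zpow_natCast, hBpow, hBy, MulAut.one_apply]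
  have hCc : ∀ v, C v (x ^ p ^ (r + 1)) = x ^ p ^ (r + 1) := fun v => by rw [map_pow, hCx]
  have hCp : C (-s) ^ p = 1 := by
    apply h.mulAut_ext
    · rw [← zpow_natCast, hCpow, hCx, MulAut.one_apply]
    · rw [← zpow_natCast, hCpow, hCy, zpow_eq_one_of_dvd h.pow_comm (dvd_mul_left _ _), one_mul,
        MulAut.one_apply]
  have hSpx : ∀ (w : ℕ), (S ^ w) x = x ^ ((g : ℤ) ^ w) := by
    intro w
    induction w with
    | zero => simp
    | succ w ih =>
      rw [pow_succ, MulAut.mul_apply, hSx, map_zpow, ih, ← zpow_mul, pow_succ]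
  have hSpc : ∀ (w : ℕ) (t : ℤ),
      (S ^ w) ((x ^ p ^ (r + 1)) ^ t) = (x ^ p ^ (r + 1)) ^ ((g : ℤ) ^ w * t) := by
    intro w t
    rw [map_zpow, map_pow, hSpx, ← Nat.cast_pow, zpow_natCast, pow_right_comm, zpow_mul,
      zpow_natCast]
  have hSc := hSpc 1
  simp only [pow_one] at hSc
  have hSpy : ∀ (w : ℕ), (S ^ w) y = y := by
    intro w
    induction w with
    | zero => simp
    | succ w ih => rw [pow_succ, MulAut.mul_apply, hSy, ih]
  have hSp : S ^ ((p - 1) * p ^ (r + 1)) = 1 := by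
    apply h.mulAut_ext
    · rw [hSpx, MulAut.one_apply]
      conv_rhs => rw [← zpow_one x]
      exact zpow_eq_zpow_of_modEq h.pow_x ((hgo _).mpr dvd_rfl)
    · rw [hSpy, MulAut.one_apply]
  have htriple : SchulteTriple p r a b (B 1) (C (-s)) S := by
    refine ⟨hBp, hCp, hSp, ?_, ?_, ?_⟩
    · rw [hBpow]
      apply h.mulAut_ext
      · rw [MulAut.mul_apply, MulAut.mul_apply, hSx, map_zpow, hBx, hBx, zpow_natCast,
          h.mul_zpow_pow, h.mul_comm_zpow, map_mul, map_zpow, map_zpow, hSx, hSy, ← zpow_mul,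
          one_mul, zpow_eq_zpow_of_modEq h.pow_y hga]
        congr 1
        apply zpow_eq_zpow_of_modEq h.pow_x
        rw [Int.modEq_iff_dvd]
        -- The factor 2 clears the denominator of the binomial coefficient and is removed since p is
        -- odd.
        have hd : (p : ℤ) ∣ 2 * (g * q * a - q * g + (1 + (p ^ (r + 1) : ℕ) * q) * g.choose 2) := by
          obtain ⟨t, ht⟩ := Int.modEq_iff_dvd.mp hga
          have hq' : (p : ℤ) = 2 * q + 1 := by exact_mod_cast hq
          have hc := two_mul_choose_two g
          refine ⟨g * a - g - g * t + (p ^ r : ℕ) * q * (2 * (g.choose 2 : ℕ)), ?_⟩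
          push_cast
          rw [pow_succ]
          linear_combination (1 : ℤ) * hc - g * (a - 1) * hq' - g * ht
        have h2 : ¬ (p : ℤ) ∣ 2 := by
          intro h2
          have := Int.le_of_dvd two_pos h2
          omega
        obtain ⟨t, ht⟩ := (hpr.dvd_or_dvd hd).resolve_left h2
        refine ⟨t, ?_⟩
        push_cast at ht ⊢
        rw [pow_succ _ (r + 1)]
        linear_combination (p : ℤ) ^ (r + 1) * ht
      · rw [MulAut.mul_apply, MulAut.mul_apply, hSy, hBy, hBy, hSy]
    · rw [hCpow]
      apply h.mulAut_ext
      · rw [MulAut.mul_apply, MulAut.mul_apply, hSx, map_zpow, hCx, hCx, hSx]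
      · rw [MulAut.mul_apply, MulAut.mul_apply, hSy, hCy, hCy, map_mul, hSy, hSc]
        congr 1
        apply zpow_eq_zpow_of_modEq h.pow_comm
        have := (((hga.mul_right b).trans hs.mul_modEq).mul_left (-s)).symm
        rwa [mul_one, mul_left_comm] at this
    · apply h.mulAut_ext
      · rw [MulAut.mul_apply, MulAut.mul_apply, MulAut.mul_apply, hSpx, hgs, hCx, zpow_add,
          zpow_mul, zpow_natCast, zpow_one, map_mul, map_zpow, hBc, hBx, map_mul, map_mul, map_zpow,
          map_zpow, map_zpow, hCx, hCy, hCc, zpow_one, zpow_one, mul_assoc, mul_assoc,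
          ← (h.commute s y).eq, ← mul_assoc (_ ^ (-s)), ← zpow_add, neg_add_cancel, zpow_zero,
          one_mul]
      · rw [MulAut.mul_apply, MulAut.mul_apply, MulAut.mul_apply, hSpy, hBy, hCy, map_mul,
          map_zpow, hBc, hBy]
  refine ⟨B 1, C (-s), S, htriple, ?_, ?_⟩
  · rw [eq_top_iff]
    intro f _
    obtain ⟨i, j, k, hi, hfx, hfy⟩ := h.mulAut_apply hp hp2 f
    -- The factor 1 - p^(r+1)qj inverts, modulo p^(r+2), the twist 1 + p^(r+1)qj of `B j`.
    have hi' : ¬ (p : ℤ) ∣ i * (1 - (p ^ (r + 1) : ℕ) * (q * j)) := by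
      intro hd
      have h2 : (p : ℤ) ∣ i * ((p ^ (r + 1) : ℕ) * (q * j)) :=
        ((Int.natCast_dvd_natCast.mpr (dvd_pow_self p (Nat.succ_ne_zero r))).mul_right _).mul_left _
      have h4 := dvd_add hd h2
      rw [← mul_add, sub_add_cancel, mul_one] at h4
      exact hi h4
    obtain ⟨w, hw⟩ := hgen _ hi'
    have hgw : ¬ (p : ℤ) ∣ g ^ w * -s := by
      intro hd
      rcases hpr.dvd_or_dvd hd with h2 | h2
      · exact hgp (hpr.dvd_of_dvd_pow h2)
      · exact hsp (dvd_neg.mp h2)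
    obtain ⟨v, hv⟩ := exists_mul_modEq (hpr.coprime_iff_not_dvd.mpr hgw).symm k
    have hf : f = S ^ w * B 1 ^ j * C (-s) ^ v := by
      rw [hBpow, hCpow]
      apply h.mulAut_ext
      · rw [MulAut.mul_apply, MulAut.mul_apply, hCx, hBx, map_mul, map_zpow, map_zpow, hSpx, hSpy,
          hfx, ← zpow_mul]
        congr 1
        apply zpow_eq_zpow_of_modEq h.pow_x
        apply Int.ModEq.symm
        refine (hw.mul_right _).trans (Int.modEq_iff_dvd.mpr ⟨i * p ^ r * (q * j) ^ 2, ?_⟩)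
        push_cast
        ring
      · rw [MulAut.mul_apply, MulAut.mul_apply, hCy, map_mul, map_zpow, hBc, hBy, map_mul,
          hSpc, hSpy, hfy]
        congr 1
        apply zpow_eq_zpow_of_modEq h.pow_comm
        rwa [mul_assoc] at hv
    rw [hf]
    exact mul_mem (mul_mem (pow_mem (Subgroup.subset_closure (by simp)) _)
      (zpow_mem (Subgroup.subset_closure (by simp)) _))
      (zpow_mem (Subgroup.subset_closure (by simp)) _)
  · intro u v w hw
    obtain ⟨k, hk, hSk⟩ : ∃ k : ℕ, w ≡ k [ZMOD (((p - 1) * p ^ (r + 1) : ℕ) : ℤ)] ∧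
        S ^ w = S ^ k := by
      have hN : (p - 1) * p ^ (r + 1) ≠ 0 := mul_ne_zero (by omega) (pow_ne_zero _ (by omega))
      have h1 : w ≡ (w % ((p - 1) * p ^ (r + 1) : ℕ)).toNat
          [ZMOD (((p - 1) * p ^ (r + 1) : ℕ) : ℤ)] := by
        rw [Int.toNat_of_nonneg (Int.emod_nonneg _ (by exact_mod_cast hN))]
        exact (Int.mod_modEq _ _).symm
      exact ⟨_, h1, by rw [zpow_eq_zpow_of_modEq hSp h1, zpow_natCast]⟩
    rw [hSk, hBpow, hCpow] at hw
    have hu : (p : ℤ) ∣ u := by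
      have h1 := DFunLike.congr_fun hw x
      rw [MulAut.mul_apply, MulAut.mul_apply, hSpx, map_zpow, map_zpow, hCx, hBx,
        MulAut.one_apply, ← Nat.cast_pow, zpow_natCast, h.mul_zpow_pow, h.mul_comm_zpow] at h1
      have h2 : ∀ i j : ℤ, x ^ i * y ^ j = x → (p : ℤ) ∣ j := fun i j hij =>
        (h.indep (-1 + i) j (by rw [zpow_add, zpow_neg_one, mul_assoc, hij, inv_mul_cancel])).2
      have h2 := h2 _ _ h1
      refine (hpr.dvd_or_dvd h2).resolve_right fun h3 => ?_
      push_cast at h3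
      exact hgp (hpr.dvd_of_dvd_pow h3)
    rw [← hBpow, zpow_eq_one_of_dvd hBp hu, one_mul] at hw
    have hkd : (p - 1) * p ^ (r + 1) ∣ k := by
      have h1 := DFunLike.congr_fun hw x
      rw [MulAut.mul_apply, hSpx, map_zpow, hCx, MulAut.one_apply] at h1
      rw [← hgo]
      apply Int.ModEq.symm
      rw [Int.modEq_iff_dvd]
      exact (h.zpow_eq_one_iff _).mp (by rw [zpow_sub_one, h1, mul_inv_cancel])
    have hSk1 : S ^ k = 1 := by
      obtain ⟨t, rfl⟩ := hkd
      rw [pow_mul, hSp, one_pow]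
    refine ⟨hu, ?_, ?_⟩
    · rw [hSk1, mul_one] at hw
      have h1 := DFunLike.congr_fun hw y
      rw [hCy, MulAut.one_apply, mul_eq_right, h.comm_zpow_eq_one_iff hp] at h1
      exact (hpr.dvd_or_dvd h1).resolve_left (by rwa [dvd_neg])
    · exact (Int.modEq_zero_iff_dvd.mp
        (hk.trans (Int.modEq_zero_iff_dvd.mpr (Int.natCast_dvd_natCast.mpr hkd))))

end MetacyclicBasis

/-! ### Normal forms in the presented metacyclic group. -/

theorem metacyclicPair_of_lift_eq_one {p r : ℕ} {B : Type*} [Group B]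
    (f : FreeGroup (Fin 2) →* B) (hf : ∀ w ∈ metacyclicRels p (r + 3), f w = 1) :
    MetacyclicPair p r (f (.of 0)) (f (.of 1)) := by
  simp only [metacyclicRels, Set.mem_insert_iff, Set.mem_singleton_iff, forall_eq_or_imp, forall_eq,
    map_mul, map_pow, map_inv, show r + 3 - 2 = r + 1 from rfl,
    show r + 3 - 1 = r + 2 from rfl] at hf
  obtain ⟨h₁, h₂, h₃⟩ := hf
  refine ⟨h₁, h₂, ?_⟩
  rw [mul_inv_eq_one, mul_assoc, inv_mul_eq_iff_eq_mul, pow_add, pow_one, ← mul_assoc] at h₃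
  exact h₃

theorem lift_eq_one_of_metacyclicPair {p r : ℕ} {B : Type*} [Group B]
    (f : FreeGroup (Fin 2) →* B) (h : MetacyclicPair p r (f (.of 0)) (f (.of 1))) :
    ∀ w ∈ metacyclicRels p (r + 3), f w = 1 := by
  simp only [metacyclicRels, Set.mem_insert_iff, Set.mem_singleton_iff, forall_eq_or_imp, forall_eq,
    map_mul, map_pow, map_inv, show r + 3 - 2 = r + 1 from rfl,
    show r + 3 - 1 = r + 2 from rfl]
  refine ⟨h.pow_x, h.pow_y, ?_⟩
  rw [mul_inv_eq_one, mul_assoc, inv_mul_eq_iff_eq_mul, pow_add, pow_one, ← mul_assoc]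
  exact h.comm

theorem MetacyclicPair.exists_eq_of_mem_closure {p r : ℕ} {G : Type*} [Group G] {x y g : G}
    (h : MetacyclicPair p r x y) (hg : g ∈ Subgroup.closure {x, y}) :
    ∃ i j : ℤ, g = x ^ i * y ^ j := by
  have hy : ∀ s i j : ℤ, ∃ i' j' : ℤ, y ^ s * (x ^ i * y ^ j) = x ^ i' * y ^ j' := by
    intro s i j
    refine ⟨i + (p ^ (r + 1) : ℕ) * -(i * s), s + j, ?_⟩
    have h1 := h.zpow_mul_zpow i s
    have h2 : y ^ s * x ^ i = x ^ i * (x ^ p ^ (r + 1)) ^ (-(i * s)) * y ^ s := by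
      rw [mul_assoc, (h.commute_y.zpow_zpow _ s).eq, ← mul_assoc, h1, zpow_neg,
        mul_inv_cancel_right]
    rw [← mul_assoc, h2, zpow_add, zpow_add, zpow_mul, zpow_natCast]
    simp only [mul_assoc]
  induction hg using Subgroup.closure_induction_left with
  | one => exact ⟨0, 0, by simp⟩
  | mul_left z hz g hg ih =>
    obtain ⟨i, j, rfl⟩ := ih
    rcases hz with rfl | rfl
    · exact ⟨1 + i, j, by rw [zpow_add, zpow_one]; simp only [mul_assoc]⟩
    · simpa using hy 1 i j
  | inv_mul_cancel z hz g hg ih =>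
    obtain ⟨i, j, rfl⟩ := ih
    rcases hz with rfl | rfl
    · exact ⟨-1 + i, j, by rw [zpow_add, zpow_neg_one]; simp only [mul_assoc]⟩
    · simpa using hy (-1) i j

/-- The faithful action of the metacyclic group on `ZMod (p ^ (r + 2))` by affine maps. -/
theorem exists_metacyclicPair_perm {p : ℕ} (hp : p.Prime) (r : ℕ) :
    ∃ x y : Equiv.Perm (ZMod (p ^ (r + 2))), MetacyclicPair p r x y ∧
      ∀ i j : ℤ, x ^ i * y ^ j = 1 → ((p ^ (r + 2) : ℕ) : ℤ) ∣ i ∧ (p : ℤ) ∣ j := by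
  set N := p ^ (r + 2) with hN
  let c : ZMod N := ((p ^ (r + 1) : ℕ) : ZMod N)
  have hcp : c * p = 0 := by
    rw [← Nat.cast_mul, ← pow_succ, ZMod.natCast_self]
  have hcc : c * c = 0 := by
    have : c = p ^ r * p := by
      simp only [c]
      push_cast
      ring
    nth_rewrite 2 [this]
    rw [mul_comm _ (p : ZMod N), ← mul_assoc, hcp, zero_mul]
  let x : Equiv.Perm (ZMod N) := Equiv.addRight 1
  -- Since c² = 0, j ↦ 1 - cj is multiplicative. The minus sign fits the right-to-left composition
  -- of permutations.
  let Y : ℤ → Equiv.Perm (ZMod N) := fun j =>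
    { toFun := fun s => (1 - c * j) * s
      invFun := fun s => (1 + c * j) * s
      left_inv := fun s => by linear_combination (-j ^ 2 * s) * hcc
      right_inv := fun s => by linear_combination (-j ^ 2 * s) * hcc }
  have hYadd : ∀ u v, Y (u + v) = Y u * Y v := by
    intro u v
    ext s
    simp only [Y, Equiv.coe_fn_mk, Equiv.Perm.mul_apply]
    push_cast
    linear_combination (-u * v * s) * hcc
  have hY := zpow_eq_of_map_add hYadd
  have hx : ∀ (k : ℕ) (s : ZMod N), (x ^ k) s = s + k := by
    intro k
    induction k with
    | zero => simp
    | succ k ih =>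
      intro s
      rw [pow_succ, Equiv.Perm.mul_apply, ih]
      simp only [x, Equiv.coe_addRight]
      push_cast
      ring
  have hxz : ∀ (k : ℤ) (s : ZMod N), (x ^ k) s = s + k := by
    intro k s
    obtain ⟨n, rfl | rfl⟩ := k.eq_nat_or_neg
    · simpa using hx n s
    · rw [zpow_neg, zpow_natCast, Equiv.Perm.inv_eq_iff_eq, hx]
      push_cast
      ring
  refine ⟨x, Y 1, ⟨?_, ?_, ?_⟩, fun i j hij => ?_⟩
  · ext s
    rw [hx, ZMod.natCast_self, add_zero, Equiv.Perm.one_apply]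
  · rw [← zpow_natCast, hY]
    ext s
    simp only [Y, Equiv.coe_fn_mk, Equiv.Perm.one_apply, Int.cast_natCast, hcp, sub_zero, one_mul]
  · ext s
    simp only [Equiv.Perm.mul_apply, hx]
    simp only [x, Y, Equiv.coe_fn_mk, Equiv.coe_addRight, Int.cast_one]
    linear_combination hcc
  · rw [hY] at hij
    have h0 : ∀ s : ZMod N, (1 - c * j) * s + i = s := by
      intro s
      have := DFunLike.congr_fun hij s
      rwa [Equiv.Perm.mul_apply, hxz, Equiv.Perm.one_apply] at this
    have hi : (i : ZMod N) = 0 := by simpa using h0 0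
    refine ⟨(ZMod.intCast_zmod_eq_zero_iff_dvd _ _).mp hi, ?_⟩
    have h1 := h0 1
    rw [hi] at h1
    have h2 : (((p ^ (r + 1) : ℕ) * j : ℤ) : ZMod N) = 0 := by
      push_cast
      simp only [c] at h1
      push_cast at h1
      linear_combination -h1
    rw [ZMod.intCast_zmod_eq_zero_iff_dvd, hN, pow_succ] at h2
    push_cast at h2
    exact (mul_dvd_mul_iff_left (pow_ne_zero _ (by exact_mod_cast hp.ne_zero))).mp h2

theorem metacyclicBasis_of {p : ℕ} (hp : p.Prime) (r : ℕ) :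
    MetacyclicBasis p r (.of 0 : MetacyclicGroup p (r + 3)) (.of 1) := by
  have hpair : MetacyclicPair p r (.of 0 : MetacyclicGroup p (r + 3)) (.of 1) :=
    metacyclicPair_of_lift_eq_one (PresentedGroup.mk _) fun w hw => PresentedGroup.one_of_mem hw
  have hlift : ∀ {B : Type} [Group B] {x' y' : B}, MetacyclicPair p r x' y' →
      ∃ f : MetacyclicGroup p (r + 3) →* B, f (.of 0) = x' ∧ f (.of 1) = y' := by
    intro B _ x' y' h
    have hrel : ∀ w ∈ metacyclicRels p (r + 3), FreeGroup.lift ![x', y'] w = 1 :=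
      lift_eq_one_of_metacyclicPair _ (by simpa using h)
    exact ⟨PresentedGroup.toGroup hrel, PresentedGroup.toGroup.of _, PresentedGroup.toGroup.of _⟩
  refine ⟨hpair, fun g => hpair.exists_eq_of_mem_closure ?_, fun i j hij => ?_, hlift⟩
  · apply PresentedGroup.generated_by
    intro j
    apply Subgroup.subset_closure
    fin_cases j <;> simp
  · obtain ⟨x, y, hxy, hind⟩ := exists_metacyclicPair_perm hp r
    obtain ⟨f, hf₀, hf₁⟩ := hlift hxy
    apply hind
    rw [← hf₀, ← hf₁, ← map_zpow, ← map_zpow, ← map_mul, hij, map_one]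

/-! ### Assembly, with j = k = 0. -/

theorem mainTheorem2 (p n : ℕ) (hp : p.Prime) (hp2 : p ≠ 2) (hn : 3 ≤ n)
    (a b : ℤ)
    (ha : ∃ u : (ZMod (p ^ (n - 2)))ˣ,
      (u : ZMod (p ^ (n - 2))) = (a : ZMod (p ^ (n - 2))) ∧ Subgroup.zpowers u = ⊤)
    (hb : a * b ≡ 1 [ZMOD (p : ℤ)]) :
    (∃ (j k : ℤ) (e : SchulteGroup p n a b j k ≃* MulAut (MetacyclicGroup p n)),
      Subgroup.center (MulAut (MetacyclicGroup p n)) =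
        Subgroup.zpowers (e (PresentedGroup.of 2) ^ (p - 1))) ∧
    Function.Surjective
      (autQuotient (Subgroup.center (MulAut (MetacyclicGroup p n)))) ∧
    ∀ φ : MulAut (MulAut (MetacyclicGroup p n) ⧸
        Subgroup.center (MulAut (MetacyclicGroup p n))),
      Nat.card {ψ : MulAut (MetacyclicGroup p n) →* MulAut (MetacyclicGroup p n) //
        IsLift φ.toMonoidHom ψ} = p ^ (n - 3) ∧
      ∀ ψ : MulAut (MetacyclicGroup p n) →* MulAut (MetacyclicGroup p n),
        IsLift φ.toMonoidHom ψ → Function.Bijective ψ := by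
  obtain ⟨r, rfl⟩ : ∃ r, n = r + 3 := ⟨n - 3, by omega⟩
  have hs : SchulteParameters p a b := SchulteParameters.of_generator hp hp2 ha hb
  obtain ⟨x₁, x₂, x₃, htriple, hgen, hindep⟩ := (metacyclicBasis_of hp r).exists_schulteTriple hs
  obtain ⟨hbasis, e, he⟩ := htriple.exists_mulEquiv hs hgen hindep
  refine ⟨⟨0, 0, e, ?_⟩, hbasis.autQuotient_surjective hs, fun φ => ⟨?_, fun ψ hψ => ?_⟩⟩
  · rw [he]
    exact hbasis.center_eq hs
  · exact hbasis.card_lifts hs φ.toMonoidHom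
  · exact hbasis.bijective_of_isLift hs hψ
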